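/- Let $\mathcal S$ and $\mathcal A$ be finite sets and consider a discounted MDP on them: action $a$ in state $s$ produces a next state and a real reward with a joint law depending only on $(s,a)$, with transition probabilities $P(s'\mid s,a)$, mean reward $R(s,a)$ and discount factor $\gamma$. Tabular action-candidate clipped Double Q-learning keeps two tables $Q^A_t,Q^B_t:\mathcal S\times\mathcal A\to\mathbb R$ with arbitrary initial values. At step $t$, in state $s_t$, an action $a_t$ is chosen by any rule based on the past, a reward $r_t$ and a next state $s_{t+1}$ are drawn from the law at $(s_t,a_t)$, and a fair coin, independent of the past and of $(r_t,s_{t+1})$, decides which table is updated. If it is $Q^A$, a number $K_t\in\{1,\dots,|\mathcal A|\}$ is chosen (fixed, or adaptively by any rule based on the information available by then), $\mathcal M_{K_t}$ is a set of $K_t$ actions having the $K_t$ largest values of $Q^B_t(s_{t+1},\cdot)$, $a^*_{K}\in\arg\max_{a\in\mathcal M_{K_t}}Q^A_t(s_{t+1},a)$ (ties broken arbitrarily), and $$Q^A_{t+1}(s_t,a_t)=Q^A_t(s_t,a_t)+\alpha_t(s_t,a_t)\Bigl(r_t+\gamma\min\bigl\{Q^B_t(s_{t+1},a^*_{K}),\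 \max_a Q^A_t(s_{t+1},a)\bigr\}-Q^A_t(s_t,a_t)\Bigr),$$ all other entries of the two tables being unchanged; if it is $Q^B$, the same is done with the roles of $A$ and $B$ exchanged. The learning rates $\alpha_t$ are determined by the past up to and including $(s_t,a_t)$. Suppose that 1. almost surely, each state-action pair is sampled infinitely often; 2. $\gamma\in[0,1)$; 3. almost surely, both $Q^A$ and $Q^B$ receive infinitely many updates; 4. almost surely, for all $(s,a)$: $\alpha_t(s,a)\in[0,1]$ for all $t$, $\sum_t\alpha_t(s,a)=\infty$, $\sum_t\alpha_t(s,a)^2<\infty$, and $\alpha_t(s,a)=0$ whenever $(s,a)\ne(s_t,a_t)$; 5. for all $(s,a)$ the reward $r(s,a)$ received after taking $a$ in $s$ has finite variance. Then the Bellman optimality equation $Q^*(s,a)=R(s,a)+\gamma\sum_{s'}P(s'\mid s,a)\max_{a'}Q^*(s',a')$ has exactly one solution $Q^*$, and the algorithm converges to the optimal policy: almost surely, $Q^A_t(s,a)\to Q^*(s,a)$ and $Q^B_t(s,a)\to Q^*(s,a)$ for all $(s,a)$, and for all sufficiently large $t$ every stationary policy that is greedy with respect to $Q^A_t$, $Q^B_t$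 or $Q^A_t+Q^B_t$ takes only actions in $\arg\max_{a}Q^*(s,a)$ in each state $s$, and maximizes the expected discounted return from every state. -/

import Mathlib

open MeasureTheory ProbabilityTheory Filter Topology

namespace ACCDQ

noncomputable section

/-- A discounted Markov decision process on a state space `S` and an action space `A`.
`law s a` is the joint law of (next state, reward) after taking action `a` in state `s`. -/
structure MDP (S A : Type*) [MeasurableSpace S] where
  /-- joint law of the next state and the reward -/
  law : S → A → Measure (S × ℝ)
  law_prob : ∀ s a, IsProbabilityMeasure (law s a)
  /-- discount factor -/
  γ : ℝ

/-- A stationary randomized policy: `prob s a` is the probability of action `a` in state `s`. -/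
structure Policy (S A : Type*) [Fintype A] where
  prob : S → A → ℝ
  nonneg : ∀ s a, 0 ≤ prob s a
  sum_eq_one : ∀ s, ∑ a, prob s a = 1

namespace MDP

variable {S A : Type*} [Fintype S] [MeasurableSpace S] [Fintype A]

/-- Transition probability `P(s' | s, a)`. -/
def trans (M : MDP S A) (s : S) (a : A) (s' : S) : ℝ :=
  (M.law s a).real {p | p.1 = s'}

/-- Mean reward `R(s, a)`. -/
def meanReward (M : MDP S A) (s : S) (a : A) : ℝ :=
  ∫ p, p.2 ∂(M.law s a)

/-- The Bellman optimality equation, the defining equation of the optimal action-value function. -/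
def IsOptimalQ (M : MDP S A) (Q : S → A → ℝ) : Prop :=
  ∀ s a, Q s a = M.meanReward s a + M.γ * ∑ s', M.trans s a s' * ⨆ a', Q s' a'

/-- Expected reward `𝔼_π[r_n | s₀ = s, a₀ = a]` at step `n`, when the policy `π` is followed from
step `1` on. -/
def stepReward (M : MDP S A) (π : Policy S A) : ℕ → S → A → ℝ
  | 0 => fun s a => M.meanReward s a
  | n + 1 => fun s a =>
      ∑ s', M.trans s a s' * ∑ a', π.prob s' a' * M.stepReward π n s' a'

/-- Action-value function of a policy: the expected discounted return
`Q^π(s, a) = 𝔼_π[∑ γ^n r_n | s₀ = s, a₀ = a]`. -/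
def qValue (M : MDP S A) (π : Policy S A) (s : S) (a : A) : ℝ :=
  ∑' n : ℕ, M.γ ^ n * M.stepReward π n s a

/-- Expected discounted return of a policy from the state `s`. -/
def value (M : MDP S A) (π : Policy S A) (s : S) : ℝ :=
  ∑ a, π.prob s a * M.qValue π s a

/-- `π` maximizes the expected discounted return from every state. -/
def IsOptimalPolicy (M : MDP S A) (π : Policy S A) : Prop :=
  ∀ (π' : Policy S A) (s : S), M.value π' s ≤ M.value π s

end MDP

/-- `π` is greedy for the table `q`: it only takes maximizing actions of `q s ·`. -/
def Policy.IsGreedy {S A : Type*} [Fintype A] (π : Policy S A) (q : S → A → ℝ) : Prop :=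
  ∀ s a, 0 < π.prob s a → ∀ b, q s b ≤ q s a

/-- `C` consists of `K` actions with the `K` largest values of `q` (ties broken arbitrarily). -/
def IsTopK {A : Type*} (q : A → ℝ) (K : ℕ) (C : Finset A) : Prop :=
  C.card = K ∧ ∀ i ∈ C, ∀ j ∉ C, q j ≤ q i

/-- `a` maximizes `q` over the candidate set `C` (ties broken arbitrarily). -/
def IsArgmaxOn {A : Type*} (q : A → ℝ) (C : Finset A) (a : A) : Prop :=
  a ∈ C ∧ ∀ b ∈ C, q b ≤ q a

/-- The clipped target `r + γ min {other(s', a*_K), max_a own(s', a)}`, where `own` is the row at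
`s'` of the table being updated and `other` that of the other table. -/
def target {A : Type*} (γ r : ℝ) (own other : A → ℝ) (aK : A) : ℝ :=
  r + γ * min (other aK) (⨆ a, own a)

open Classical in
/-- The table `q` after moving the entry `(s, a)` towards `y` with step size `α`. -/
def updateEntry {S A : Type*} (q : S → A → ℝ) (s : S) (a : A) (α y : ℝ) : S → A → ℝ :=
  fun s' a' => if s' = s ∧ a' = a then q s a + α * (y - q s a) else q s' a'

/-- A run of tabular action-candidate clipped Double Q-learning on the MDP `M`, on a probability
space `(Ω, μ)`. `ℱ t` is the information available when the action of step `t` has been chosen and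
before its outcome and the choice of the table to update are drawn. The rule by which actions are
chosen and the rule by which the numbers of candidates are chosen are arbitrary. -/
structure Run {S A : Type*} [MeasurableSpace S] [Fintype A] [MeasurableSpace A]
    (M : MDP S A) {Ω : Type*} [mΩ : MeasurableSpace Ω] (μ : Measure Ω) where
  ℱ : Filtration ℕ mΩ
  /-- current state `s_t` -/
  state : ℕ → Ω → S
  /-- action `a_t` -/
  action : ℕ → Ω → A
  /-- reward `r_t` received after `a_t` -/
  reward : ℕ → Ω → ℝ
  /-- learning rates `α_t(s, a)` -/
  α : ℕ → Ω → S → A → ℝ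
  /-- `true` if `Q^A` is updated at step `t`, `false` if `Q^B` is -/
  updA : ℕ → Ω → Bool
  /-- number of candidates used at step `t` -/
  K : ℕ → Ω → ℕ
  /-- candidate set used at step `t` -/
  cand : ℕ → Ω → Finset A
  /-- the selected candidate `a*_K` at step `t` -/
  aK : ℕ → Ω → A
  QA : ℕ → Ω → S → A → ℝ
  QB : ℕ → Ω → S → A → ℝ
  state_meas : ∀ t, Measurable[ℱ t] (state t)
  action_meas : ∀ t, Measurable[ℱ t] (action t)
  α_meas : ∀ t s a, Measurable[ℱ t] (fun ω => α t ω s a)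
  QA_meas : ∀ t s a, Measurable[ℱ t] (fun ω => QA t ω s a)
  QB_meas : ∀ t s a, Measurable[ℱ t] (fun ω => QB t ω s a)
  reward_meas : ∀ t, Measurable[ℱ (t + 1)] (reward t)
  updA_meas : ∀ t, Measurable[ℱ (t + 1)] (updA t)
  K_meas : ∀ t, Measurable[ℱ (t + 1)] (K t)
  aK_meas : ∀ t, Measurable[ℱ (t + 1)] (aK t)
  /-- Given the information at step `t`, the next state and the reward are drawn from
  `M.law s_t a_t`, and independently of them a fair coin selects the table to update. -/
  step_law : ∀ (t : ℕ) (s : S) (a : A) (E : Set Ω), MeasurableSet[ℱ t] E →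
    ∀ B : Set (S × ℝ), MeasurableSet B → ∀ c : Bool,
      μ (E ∩ {ω | state t ω = s ∧ action t ω = a} ∩
          {ω | updA t ω = c ∧ (state (t + 1) ω, reward t ω) ∈ B})
        = 2⁻¹ * M.law s a B * μ (E ∩ {ω | state t ω = s ∧ action t ω = a})
  K_range : ∀ t ω, 1 ≤ K t ω ∧ K t ω ≤ Fintype.card A
  /-- When `Q^A` is updated, the candidates are the top `K` actions of `Q^B(s', ·)` and `a*_K`
  maximizes `Q^A(s', ·)` among them; only the entry `(s_t, a_t)` of `Q^A` changes. -/
  stepA : ∀ t ω, updA t ω = true →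
    IsTopK (QB t ω (state (t + 1) ω)) (K t ω) (cand t ω) ∧
    IsArgmaxOn (QA t ω (state (t + 1) ω)) (cand t ω) (aK t ω) ∧
    QA (t + 1) ω = updateEntry (QA t ω) (state t ω) (action t ω)
      (α t ω (state t ω) (action t ω))
      (target M.γ (reward t ω) (QA t ω (state (t + 1) ω)) (QB t ω (state (t + 1) ω)) (aK t ω)) ∧
    QB (t + 1) ω = QB t ω
  /-- The same with the two tables exchanged. -/
  stepB : ∀ t ω, updA t ω = false →
    IsTopK (QA t ω (state (t + 1) ω)) (K t ω) (cand t ω) ∧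
    IsArgmaxOn (QB t ω (state (t + 1) ω)) (cand t ω) (aK t ω) ∧
    QB (t + 1) ω = updateEntry (QB t ω) (state t ω) (action t ω)
      (α t ω (state t ω) (action t ω))
      (target M.γ (reward t ω) (QB t ω (state (t + 1) ω)) (QA t ω (state (t + 1) ω)) (aK t ω)) ∧
    QA (t + 1) ω = QA t ω

end

end ACCDQ

/-! The core is a deterministic scheme, entry by entry: Δ_{t+1} = (1 - a_t) Δ_t + a_t u_t + n_t,
where the series of the n_t converges and |u_t| ≤ γ ‖Δ_t‖ + c_t with c_t → 0. Subtracting the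
averaged noise leaves a weighted average of the u_t, so an eventual bound B on Δ improves to nearly
γB, and Δ → 0 (`tendsto_zero_of_contraction`). The noise series converge pathwise by martingale
convergence, because the weights are square summable and known before the outcome
(`ae_exists_tendsto_sum_noise`).

Whatever the number of candidates, if the tables differ by at most δ, the clipped value is at most δ
below the maximum of the table being updated, and never above it (`iSup_sub_le_of_isTopK`). Hence,
once the tables merge, each of them performs Q-learning with a vanishing perturbation and converges
to the fixed point Q* (`ae_tendsto_QA`).

Merging (`ae_tendsto_gap`) is the delicate point. For Q^A - Q^B the fair coin produces the rate α/2,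
and it makes every coin-independent part of the target a noise of random sign. The clipped value
itself may depend on the coin, but it lies in [m - gap, m], where m is the smaller of the two maxima
at the next state. Measured from the midpoint of this interval the error is at most gap/2; relative
to the rate α/2 this gives the factor γ. Measured from m, it would only give 2γ.

Greedy policies for the tables are eventually greedy for Q*, since only finitely many strict
inequalities have to persist. -/

namespace ACCDQ

/-! ### Averaging recursions with divergent step sums, and averaged noise -/

section Averaging

theorem eventually_le_of_averaging {a u y : ℕ → ℝ} (ha0 : ∀ t, 0 ≤ a t) (ha1 : ∀ t, a t ≤ 1)
    (hsum : Tendsto (fun n => ∑ t ∈ Finset.range n, a t) atTop atTop)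
    (hrec : ∀ t, y (t + 1) = (1 - a t) * y t + a t * u t) {B ε : ℝ}
    (hu : ∀ᶠ t in atTop, u t ≤ B) (hε : 0 < ε) : ∀ᶠ t in atTop, y t ≤ B + ε := by
  obtain ⟨T, hT⟩ := eventually_atTop.1 hu
  set s : ℕ → ℝ := fun n => ∑ t ∈ Finset.range n, a t with hs
  -- The absolute value keeps the majorant nonnegative, so that 1 - a may be replaced by exp(-a) in
  -- the induction.
  have hdecay : ∀ t, T ≤ t → y t - B ≤ |y T - B| * Real.exp (s T - s t) := by
    intro t ht
    induction t, ht using Nat.le_induction with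
    | base => simpa using le_abs_self (y T - B)
    | succ t ht ih =>
      have h1 : y (t + 1) - B ≤ (1 - a t) * (y t - B) := by
        rw [hrec]
        nlinarith [mul_le_mul_of_nonneg_left (hT t ht) (ha0 t)]
      have h2 : s T - s (t + 1) = (s T - s t) + -a t := by
        simp only [hs, Finset.sum_range_succ]; ring
      have h3 : 1 - a t ≤ Real.exp (-a t) := by
        have := Real.add_one_le_exp (-a t); linarith
      rw [h2, Real.exp_add, ← mul_assoc]
      calc y (t + 1) - B ≤ (1 - a t) * (y t - B) := h1
        _ ≤ (1 - a t) * (|y T - B| * Real.exp (s T - s t)) :=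
          mul_le_mul_of_nonneg_left ih (by linarith [ha1 t])
        _ ≤ Real.exp (-a t) * (|y T - B| * Real.exp (s T - s t)) :=
          mul_le_mul_of_nonneg_right h3 (by positivity)
        _ = _ := by ring
  have hlim : Tendsto (fun t => |y T - B| * Real.exp (s T - s t)) atTop (𝓝 0) := by
    have h1 : Tendsto (fun t => s T - s t) atTop atBot :=
      tendsto_atBot_add_const_left _ (s T) (tendsto_neg_atTop_atBot.comp hsum)
    simpa using (Real.tendsto_exp_atBot.comp h1).const_mul |y T - B|
  filter_upwards [eventually_ge_atTop T, hlim.eventually (gt_mem_nhds hε)] with t ht h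
  linarith [hdecay t ht]

theorem eventually_abs_le_of_averaging {a u y : ℕ → ℝ} (ha0 : ∀ t, 0 ≤ a t)
    (ha1 : ∀ t, a t ≤ 1) (hsum : Tendsto (fun n => ∑ t ∈ Finset.range n, a t) atTop atTop)
    (hrec : ∀ t, y (t + 1) = (1 - a t) * y t + a t * u t) {B ε : ℝ}
    (hu : ∀ᶠ t in atTop, |u t| ≤ B) (hε : 0 < ε) : ∀ᶠ t in atTop, |y t| ≤ B + ε := by
  have h1 := eventually_le_of_averaging ha0 ha1 hsum hrec
    (hu.mono fun t h => (abs_le.1 h).2) hε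
  have h2 := eventually_le_of_averaging (u := fun t => -u t) (y := fun t => -y t) ha0 ha1 hsum
    (fun t => by rw [hrec]; ring) (hu.mono fun t h => neg_le.1 (abs_le.1 h).1) hε
  filter_upwards [h1, h2] with t h1 h2
  exact abs_le.2 ⟨by linarith, h1⟩

theorem tendsto_zero_of_averaging {a u y : ℕ → ℝ} (ha0 : ∀ t, 0 ≤ a t) (ha1 : ∀ t, a t ≤ 1)
    (hsum : Tendsto (fun n => ∑ t ∈ Finset.range n, a t) atTop atTop)
    (hrec : ∀ t, y (t + 1) = (1 - a t) * y t + a t * u t) (hu : Tendsto u atTop (𝓝 0)) :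
    Tendsto y atTop (𝓝 0) := by
  rw [Metric.tendsto_atTop']
  intro ε hε
  have hu' : ∀ᶠ t in atTop, |u t| ≤ ε / 3 := by
    filter_upwards [Metric.tendsto_nhds.1 hu (ε / 3) (by positivity)] with t ht
    simpa [Real.dist_eq] using ht.le
  obtain ⟨T, hT⟩ := eventually_atTop.1 (eventually_abs_le_of_averaging ha0 ha1 hsum hrec hu'
    (ε := ε / 3) (by positivity))
  refine ⟨T, fun t ht => ?_⟩
  have := hT t ht.le
  rw [Real.dist_eq, sub_zero]
  linarith

/-- The solution of `W (t+1) = (1 - a t) W t + n t`, `W 0 = 0`. -/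
noncomputable def noiseAverage (a n : ℕ → ℝ) : ℕ → ℝ
  | 0 => 0
  | t + 1 => (1 - a t) * noiseAverage a n t + n t

/-- Summation by parts in recursive form: after subtracting the centred partial sums, the noise
enters only through an average of quantities that tend to 0 when `l` is the sum of the series. The
choice `l = 0` serves for boundedness. -/
theorem noiseAverage_sub_sum (a n : ℕ → ℝ) (l : ℝ) (t : ℕ) :
    noiseAverage a n (t + 1) - (∑ i ∈ Finset.range (t + 1), n i - l)
      = (1 - a t) * (noiseAverage a n t - (∑ i ∈ Finset.range t, n i - l))
        + a t * -(∑ i ∈ Finset.range t, n i - l) := by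
  rw [noiseAverage, Finset.sum_range_succ]
  ring

theorem tendsto_noiseAverage {a n : ℕ → ℝ} (ha0 : ∀ t, 0 ≤ a t) (ha1 : ∀ t, a t ≤ 1)
    (hsum : Tendsto (fun n => ∑ t ∈ Finset.range n, a t) atTop atTop) {l : ℝ}
    (hn : Tendsto (fun k => ∑ t ∈ Finset.range k, n t) atTop (𝓝 l)) :
    Tendsto (noiseAverage a n) atTop (𝓝 0) := by
  have hN : Tendsto (fun k => ∑ t ∈ Finset.range k, n t - l) atTop (𝓝 0) := by
    simpa using hn.sub_const l
  have hN' : Tendsto (fun k => -(∑ t ∈ Finset.range k, n t - l)) atTop (𝓝 0) := by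
    simpa only [neg_zero] using hN.neg
  have := (tendsto_zero_of_averaging
    (y := fun t => noiseAverage a n t - (∑ i ∈ Finset.range t, n i - l)) ha0 ha1 hsum
    (noiseAverage_sub_sum a n l) hN').add hN
  simpa using this

theorem exists_bound_noiseAverage {a n : ℕ → ℝ} (ha0 : ∀ t, 0 ≤ a t) (ha1 : ∀ t, a t ≤ 1)
    {l : ℝ} (hn : Tendsto (fun k => ∑ t ∈ Finset.range k, n t) atTop (𝓝 l)) :
    ∃ B, ∀ t, |noiseAverage a n t| ≤ B := by
  obtain ⟨C, hC⟩ := hn.norm.bddAbove_range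
  have hC' : ∀ t, |∑ i ∈ Finset.range t, n i| ≤ C := fun t => hC ⟨t, rfl⟩
  have hC0 : 0 ≤ C := (abs_nonneg _).trans (hC' 0)
  have h : ∀ t, |noiseAverage a n t - ∑ i ∈ Finset.range t, n i| ≤ C := by
    intro t
    induction t with
    | zero => simpa [noiseAverage] using hC0
    | succ t ih =>
      have := noiseAverage_sub_sum a n 0 t
      simp only [sub_zero] at this
      rw [this]
      have h1 := abs_le.1 ih
      have h2 := abs_le.1 (hC' t)
      have h3 : 0 ≤ 1 - a t := by linarith [ha1 t]
      rw [abs_le]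
      constructor <;> nlinarith [ha0 t]
  refine ⟨C + C, fun t => ?_⟩
  calc |noiseAverage a n t|
      = |(noiseAverage a n t - ∑ i ∈ Finset.range t, n i) + ∑ i ∈ Finset.range t, n i| := by
        rw [sub_add_cancel]
    _ ≤ _ := (abs_add_le _ _).trans (add_le_add (h t) (hC' t))

end Averaging

/-! ### Noisy asynchronous contraction schemes -/

section Contraction

variable {Z : Type*} [Finite Z]

/-- Iterates of a noisy asynchronous contraction scheme stay bounded. -/
theorem exists_bound_of_contraction {a n u Δ : ℕ → Z → ℝ} {γ C : ℝ} (hγ1 : γ < 1)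
    (ha0 : ∀ t z, 0 ≤ a t z) (ha1 : ∀ t z, a t z ≤ 1)
    (hn : ∀ z, ∃ l, Tendsto (fun k => ∑ t ∈ Finset.range k, n t z) atTop (𝓝 l))
    (hrec : ∀ t z, Δ (t + 1) z = (1 - a t z) * Δ t z + a t z * u t z + n t z)
    (hu : ∀ t B, (∀ z, |Δ t z| ≤ B) → ∀ z, |u t z| ≤ γ * B + C) :
    ∃ B, ∀ t z, |Δ t z| ≤ B := by
  have hW : ∀ z, ∃ B, ∀ t, |noiseAverage (a · z) (n · z) t| ≤ B := fun z =>
    exists_bound_noiseAverage (fun t => ha0 t z) (fun t => ha1 t z) (hn z).choose_spec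
  choose w hw using hW
  obtain ⟨w', hw'⟩ := Set.Finite.bddAbove (Set.finite_range w)
  obtain ⟨d, hd⟩ := Set.Finite.bddAbove (Set.finite_range fun z => |Δ 0 z|)
  have hww : ∀ z t, |noiseAverage (a · z) (n · z) t| ≤ w' := fun z t =>
    (hw z t).trans (hw' ⟨z, rfl⟩)
  have hγ : 0 < 1 - γ := by linarith
  -- `Y` dominates the initial values and is large enough that γ(Y + w') + C ≤ Y; the interval [-Y,
  -- Y] is then invariant for Δ minus the averaged noise.
  set Y := max d ((γ * w' + C) / (1 - γ)) with hY
  have hYC : γ * (Y + w') + C ≤ Y := by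
    have : (γ * w' + C) / (1 - γ) ≤ Y := le_max_right _ _
    rw [div_le_iff₀ hγ] at this
    linarith
  have key : ∀ t z, |Δ t z - noiseAverage (a · z) (n · z) t| ≤ Y := by
    intro t
    induction t with
    | zero => 
      intro z
      rw [noiseAverage, sub_zero]
      exact (hd ⟨z, rfl⟩).trans (le_max_left _ _)
    | succ t ih =>
      intro z
      have hΔ : ∀ z, |Δ t z| ≤ Y + w' := fun z => by
        have := abs_add_le (Δ t z - noiseAverage (a · z) (n · z) t)
          (noiseAverage (a · z) (n · z) t)
        rw [sub_add_cancel] at this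
        linarith [ih z, hww z t]
      have h1 := abs_le.1 ((hu t _ hΔ z).trans hYC)
      have h2 := abs_le.1 (ih z)
      have h3 : 0 ≤ 1 - a t z := by linarith [ha1 t z]
      have h4 : Δ (t + 1) z - noiseAverage (a · z) (n · z) (t + 1)
          = (1 - a t z) * (Δ t z - noiseAverage (a · z) (n · z) t) + a t z * u t z := by
        rw [hrec, noiseAverage]; ring
      rw [h4, abs_le]
      constructor <;> nlinarith [ha0 t z]
  refine ⟨Y + w', fun t z => ?_⟩
  have := abs_add_le (Δ t z - noiseAverage (a · z) (n · z) t) (noiseAverage (a · z) (n · z) t)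
  rw [sub_add_cancel] at this
  linarith [key t z, hww z t]

/-- Bounded iterates of a noisy asynchronous contraction scheme with vanishing perturbation
converge to zero. -/
theorem tendsto_zero_of_contraction {a n u Δ : ℕ → Z → ℝ} {c : ℕ → ℝ} {γ : ℝ} (hγ0 : 0 ≤ γ)
    (hγ1 : γ < 1) (ha0 : ∀ t z, 0 ≤ a t z) (ha1 : ∀ t z, a t z ≤ 1)
    (hsum : ∀ z, Tendsto (fun n => ∑ t ∈ Finset.range n, a t z) atTop atTop)
    (hn : ∀ z, ∃ l, Tendsto (fun k => ∑ t ∈ Finset.range k, n t z) atTop (𝓝 l))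
    (hrec : ∀ t z, Δ (t + 1) z = (1 - a t z) * Δ t z + a t z * u t z + n t z)
    (hu : ∀ t B, (∀ z, |Δ t z| ≤ B) → ∀ z, |u t z| ≤ γ * B + c t)
    (hc : Tendsto c atTop (𝓝 0)) (hbdd : ∃ B, ∀ t z, |Δ t z| ≤ B) (z : Z) :
    Tendsto (fun t => Δ t z) atTop (𝓝 0) := by
  have hW : ∀ z, Tendsto (noiseAverage (a · z) (n · z)) atTop (𝓝 0) := fun z =>
    tendsto_noiseAverage (fun t => ha0 t z) (fun t => ha1 t z) (hsum z) (hn z).choose_spec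
  -- The three ε pay for `c t`, for the averaging lemma and for the averaged noise.
  have step : ∀ B ε, 0 < ε → (∀ᶠ t in atTop, ∀ z, |Δ t z| ≤ B) →
      ∀ᶠ t in atTop, ∀ z, |Δ t z| ≤ γ * B + 3 * ε := by
    intro B ε hε hB
    rw [eventually_all]
    intro z
    have hu' : ∀ᶠ t in atTop, |u t z| ≤ γ * B + ε := by
      filter_upwards [hB, hc.eventually (gt_mem_nhds hε)] with t h1 h2
      linarith [hu t B h1 z]
    have h1 := eventually_abs_le_of_averaging (fun t => ha0 t z) (fun t => ha1 t z) (hsum z)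
      (y := fun t => Δ t z - noiseAverage (a · z) (n · z) t)
      (fun t => by simp only [hrec, noiseAverage]; ring) hu' hε
    have h2 := Metric.tendsto_nhds.1 (hW z) ε hε
    filter_upwards [h1, h2] with t h1 h2
    rw [Real.dist_eq, sub_zero] at h2
    have := abs_add_le (Δ t z - noiseAverage (a · z) (n · z) t) (noiseAverage (a · z) (n · z) t)
    rw [sub_add_cancel] at this
    linarith
  -- The infimum L of the eventual bounds plays the role of the limsup of the sup norm.
  set I : Set ℝ := {B | ∀ᶠ t in atTop, ∀ z, |Δ t z| ≤ B} with hI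
  have hne : I.Nonempty := let ⟨B, hB⟩ := hbdd; ⟨B, Eventually.of_forall hB⟩
  have hpos : ∀ B ∈ I, 0 ≤ B := fun B hB =>
    let ⟨t, ht⟩ := hB.exists; (abs_nonneg _).trans (ht z)
  have hbb : BddBelow I := ⟨0, hpos⟩
  have hL0 : 0 ≤ sInf I := le_csInf hne hpos
  have hL : sInf I ≤ 0 := by
    by_contra hcon
    push Not at hcon
    set L := sInf I with hLdef
    -- For B < L + ε the improved bound is below γL + 4ε = γL + (1 - γ)L/2, which is less than L.
    set ε := (1 - γ) * L / 8 with hε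
    have hε0 : 0 < ε := by have : 0 < 1 - γ := by linarith
                           positivity
    obtain ⟨B, hB, hBL⟩ := exists_lt_of_csInf_lt hne (show sInf I < L + ε by linarith)
    have h1 : L ≤ γ * B + 3 * ε := csInf_le hbb (step B ε hε0 hB)
    nlinarith
  rw [Metric.tendsto_nhds]
  intro ε hε
  obtain ⟨B, hB, hBL⟩ := exists_lt_of_csInf_lt hne (show sInf I < ε by linarith)
  filter_upwards [hB] with t ht
  rw [Real.dist_eq, sub_zero]
  exact (ht z).trans_lt hBL

end Contraction

/-! ### Maxima of rows and the clipped candidate value -/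

section Candidate

variable {A : Type*} [Finite A]

theorem abs_iSup_sub_iSup_le [Nonempty A] {p q : A → ℝ} {δ : ℝ} (h : ∀ a, |p a - q a| ≤ δ) :
    |(⨆ a, p a) - ⨆ a, q a| ≤ δ := by
  have hp : BddAbove (Set.range p) := Set.Finite.bddAbove (Set.finite_range p)
  have hq : BddAbove (Set.range q) := Set.Finite.bddAbove (Set.finite_range q)
  have h1 : (⨆ a, p a) ≤ (⨆ a, q a) + δ :=
    ciSup_le fun a => by linarith [(abs_le.1 (h a)).2, le_ciSup hq a]
  have h2 : (⨆ a, q a) ≤ (⨆ a, p a) + δ :=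
    ciSup_le fun a => by linarith [(abs_le.1 (h a)).1, le_ciSup hp a]
  exact abs_le.2 ⟨by linarith, by linarith⟩

theorem abs_iSup_le [Nonempty A] {p : A → ℝ} {δ : ℝ} (h : ∀ a, |p a| ≤ δ) :
    |⨆ a, p a| ≤ δ := by
  simpa using abs_iSup_sub_iSup_le (p := p) (q := fun _ => 0) (by simpa using h)

-- An action b in `C` satisfies own b ≤ own a ≤ other a + δ by the choice of a; one outside `C`
-- satisfies own b ≤ other b + δ ≤ other a + δ by the top-K property. So the size of `C` plays no
-- role.
omit [Finite A] in
theorem iSup_sub_le_of_isTopK [Nonempty A] {own other : A → ℝ} {K : ℕ} {C : Finset A} {a : A}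
    {δ : ℝ} (hC : IsTopK other K C) (ha : IsArgmaxOn own C a) (h : ∀ b, |own b - other b| ≤ δ) :
    (⨆ b, own b) - δ ≤ min (other a) (⨆ b, own b) := by
  have hδ : 0 ≤ δ := (abs_nonneg _).trans (h a)
  refine le_min (sub_le_iff_le_add.2 (ciSup_le fun b => ?_)) (by linarith)
  by_cases hb : b ∈ C
  · linarith [ha.2 b hb, (abs_le.1 (h a)).2]
  · linarith [hC.2 a ha.1 b hb, (abs_le.1 (h b)).2]

end Candidate

/-! ### Convergence of weighted sums of martingale differences -/

section Martingale

variable {Ω : Type*} {mΩ : MeasurableSpace Ω} {μ : Measure Ω} [IsProbabilityMeasure μ]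
  {ℱ : Filtration ℕ mΩ} {ξ β : ℕ → Ω → ℝ}

/-- An `L²` martingale convergence theorem for weighted sums of martingale differences, with
weights whose squares have a bounded sum. -/
theorem ae_exists_tendsto_sum_of_sum_sq_le (hβ : ∀ t, Measurable[ℱ t] (β t))
    (hξm : ∀ t, Measurable[ℱ (t + 1)] (ξ t)) (hξ2 : ∀ t, MemLp (ξ t) 2 μ)
    (h0 : ∀ t, μ[ξ t | ℱ t] =ᵐ[μ] 0) {C : ℝ}
    (hC : ∀ t, μ[fun ω => ξ t ω ^ 2 | ℱ t] ≤ᵐ[μ] fun _ => C) {N : ℝ}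
    (hN : ∀ n ω, ∑ t ∈ Finset.range n, β t ω ^ 2 ≤ N) :
    ∀ᵐ ω ∂μ, ∃ l, Tendsto (fun n => ∑ t ∈ Finset.range n, β t ω * ξ t ω) atTop (𝓝 l) := by
  have hβb : ∀ t ω, |β t ω| ≤ √N := fun t ω => by
    refine Real.abs_le_sqrt (le_trans ?_ (hN (t + 1) ω))
    exact Finset.single_le_sum (f := fun i => β i ω ^ 2) (fun i _ => sq_nonneg _)
      (Finset.self_mem_range_succ t)
  have hC0 : 0 ≤ C := by
    have h1 : 0 ≤ᵐ[μ] μ[fun ω => ξ 0 ω ^ 2 | ℱ 0] :=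
      condExp_nonneg (Eventually.of_forall fun ω => sq_nonneg _)
    obtain ⟨ω, h1, h2⟩ := (h1.and (hC 0)).exists
    exact h1.trans h2
  have hβm : ∀ t, Measurable (β t) := fun t => (hβ t).mono (ℱ.le t) le_rfl
  have hmul : ∀ t, MemLp (fun ω => β t ω * ξ t ω) 2 μ := fun t =>
    (MemLp.of_le_mul (c := √N) (hξ2 t)
      ((hβm t).aestronglyMeasurable.mul (hξ2 t).1)
      (Eventually.of_forall fun ω => by
        rw [norm_mul]; exact mul_le_mul_of_nonneg_right (hβb t ω) (norm_nonneg _)))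
  set S : ℕ → Ω → ℝ := fun n ω => ∑ t ∈ Finset.range n, β t ω * ξ t ω with hS
  have hSL : ∀ n, MemLp (S n) 2 μ := fun n => memLp_finsetSum _ fun t _ => hmul t
  have hSm : ∀ n, Measurable[ℱ n] (S n) := fun n => by
    refine Finset.measurable_sum _ fun t ht => ?_
    have ht' : t < n := Finset.mem_range.1 ht
    exact ((hβ t).mono (ℱ.mono ht'.le) le_rfl).mul ((hξm t).mono (ℱ.mono ht') le_rfl)
  have hsucc : ∀ n, S (n + 1) = S n + fun ω => β n ω * ξ n ω := fun n => by
    ext ω; simp [hS, Finset.sum_range_succ]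
  have hce : ∀ n (f : Ω → ℝ), Measurable[ℱ n] f → Integrable (fun ω => f ω * ξ n ω) μ →
      μ[fun ω => f ω * ξ n ω | ℱ n] =ᵐ[μ] 0 := by
    intro n f hf hi
    have := condExp_mul_of_stronglyMeasurable_left (μ := μ) (m := ℱ n) (f := f) (g := ξ n)
      hf.stronglyMeasurable hi ((hξ2 n).integrable (by norm_num))
    refine this.trans ?_
    filter_upwards [h0 n] with ω hω
    simp [hω]
  have hmart : Martingale S ℱ μ := by
    refine martingale_nat (fun n => (hSm n).stronglyMeasurable)
      (fun n => (hSL n).integrable (by norm_num)) fun n => ?_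
    rw [hsucc]
    have h1 := condExp_add (μ := μ) ((hSL n).integrable (by norm_num))
      ((hmul n).integrable (by norm_num)) (ℱ n)
    have h2 := hce n (β n) (hβ n) ((hmul n).integrable (by norm_num))
    have h3 := condExp_of_stronglyMeasurable (ℱ.le n) (hSm n).stronglyMeasurable
      ((hSL n).integrable (μ := μ) (by norm_num))
    filter_upwards [h1, h2] with ω h1 h2
    rw [h1, Pi.add_apply, h2, h3]
    simp
  have hβ2i : ∀ n, Integrable (fun ω => β n ω ^ 2) μ := fun n =>
    Integrable.of_bound ((hβm n).pow_const 2).aestronglyMeasurable (√N ^ 2)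
      (Eventually.of_forall fun ω => by
        rw [norm_pow]; exact pow_le_pow_left₀ (norm_nonneg _) (hβb n ω) 2)
  -- Increments are orthogonal: `S n * β n` is known at time n, so its product with `ξ n` has mean
  -- zero and only the squares accumulate.
  have hL2 : ∀ n, ∫ ω, S n ω ^ 2 ∂μ ≤ C * ∫ ω, ∑ t ∈ Finset.range n, β t ω ^ 2 ∂μ := by
    intro n
    induction n with
    | zero => simp [hS]
    | succ n ih =>
      have hcross : ∫ ω, (S n ω * β n ω) * ξ n ω ∂μ = 0 := by
        have hi : Integrable (fun ω => (S n ω * β n ω) * ξ n ω) μ := by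
          have := (hSL n).integrable_mul (hmul n)
          refine this.congr (Eventually.of_forall fun ω => ?_)
          simp [mul_assoc]
        have h1 := integral_congr_ae (hce n (fun ω => S n ω * β n ω) ((hSm n).mul (hβ n)) hi)
        rw [integral_condExp (ℱ.le n)] at h1
        simpa using h1
      have hξ2i : Integrable (fun ω => ξ n ω ^ 2) μ := (hξ2 n).integrable_sq
      have hi2 : Integrable (fun ω => β n ω ^ 2 * ξ n ω ^ 2) μ :=
        (hmul n).integrable_sq.congr (Eventually.of_forall fun ω => by simp [mul_pow])
      have hsq : ∫ ω, β n ω ^ 2 * ξ n ω ^ 2 ∂μ ≤ C * ∫ ω, β n ω ^ 2 ∂μ := by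
        rw [← integral_condExp (ℱ.le n), ← integral_const_mul]
        have h1 := condExp_mul_of_stronglyMeasurable_left (μ := μ) (m := ℱ n)
          (f := fun ω => β n ω ^ 2) (g := fun ω => ξ n ω ^ 2)
          ((hβ n).pow_const 2).stronglyMeasurable hi2 hξ2i
        refine integral_mono_ae integrable_condExp ((hβ2i n).const_mul C) ?_
        filter_upwards [h1, hC n] with ω h1 h2
        refine h1.le.trans ?_
        rw [Pi.mul_apply, mul_comm C]
        exact mul_le_mul_of_nonneg_left h2 (sq_nonneg _)
      have hexp : ∫ ω, S (n + 1) ω ^ 2 ∂μ = ∫ ω, S n ω ^ 2 ∂μ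
          + 2 * ∫ ω, (S n ω * β n ω) * ξ n ω ∂μ + ∫ ω, β n ω ^ 2 * ξ n ω ^ 2 ∂μ := by
        have hi : Integrable (fun ω => (S n ω * β n ω) * ξ n ω) μ := by
          have := (hSL n).integrable_mul (hmul n)
          refine this.congr (Eventually.of_forall fun ω => ?_)
          simp [mul_assoc]
        have e1 : ∫ ω, (S n ω ^ 2 + 2 * (S n ω * β n ω * ξ n ω)) ∂μ = _ :=
          integral_add (hSL n).integrable_sq (hi.const_mul 2)
        have e2 : ∫ ω, (S n ω ^ 2 + 2 * (S n ω * β n ω * ξ n ω) + β n ω ^ 2 * ξ n ω ^ 2) ∂μ = _ :=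
          integral_add ((hSL n).integrable_sq.add (hi.const_mul 2)) hi2
        rw [← integral_const_mul, ← e1, ← e2]
        refine integral_congr_ae (Eventually.of_forall fun ω => ?_)
        simp only [hsucc, Pi.add_apply]
        ring
      have hsum : ∫ ω, ∑ t ∈ Finset.range (n + 1), β t ω ^ 2 ∂μ
          = ∫ ω, ∑ t ∈ Finset.range n, β t ω ^ 2 ∂μ + ∫ ω, β n ω ^ 2 ∂μ := by
        simp only [Finset.sum_range_succ]
        exact integral_add (integrable_finsetSum _ fun t _ => hβ2i t) (hβ2i n)
      rw [hexp, hcross, hsum, mul_add]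
      linarith
  have hL1 : ∀ n, eLpNorm (S n) 1 μ ≤ ((1 + C * N).toNNReal : ENNReal) := by
    intro n
    have h1 : ∫ ω, S n ω ^ 2 ∂μ ≤ C * N := by
      refine (hL2 n).trans (mul_le_mul_of_nonneg_left ?_ hC0)
      calc ∫ ω, ∑ t ∈ Finset.range n, β t ω ^ 2 ∂μ ≤ ∫ _, N ∂μ :=
            integral_mono (integrable_finsetSum _ fun t _ => hβ2i t) (integrable_const _) (hN n)
        _ = N := by simp
    -- Doob's theorem needs only an L¹ bound, which |x| ≤ 1 + x² extracts from the L² one.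
    have h2 : ∫ ω, ‖S n ω‖ ∂μ ≤ 1 + C * N := by
      calc ∫ ω, ‖S n ω‖ ∂μ ≤ ∫ ω, (1 + S n ω ^ 2) ∂μ := by
            refine integral_mono ((hSL n).integrable (by norm_num)).norm
              ((integrable_const _).add (hSL n).integrable_sq) fun ω => ?_
            simp only [Real.norm_eq_abs]
            nlinarith [sq_abs (S n ω), sq_nonneg (|S n ω| - 1), abs_nonneg (S n ω)]
        _ = 1 + ∫ ω, S n ω ^ 2 ∂μ := by
            rw [integral_add (integrable_const _) (hSL n).integrable_sq]; simp
        _ ≤ _ := by linarith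
    rw [eLpNorm_one_eq_lintegral_enorm,
      ← ofReal_integral_norm_eq_lintegral_enorm ((hSL n).integrable (by norm_num))]
    exact ENNReal.ofReal_le_ofReal h2
  exact hmart.submartingale.exists_ae_tendsto_of_bdd hL1

/-- A weighted sum of martingale differences with bounded conditional variance converges almost
surely if the squares of the weights are almost surely summable. -/
theorem ae_exists_tendsto_sum_of_summable_sq (hβ : ∀ t, Measurable[ℱ t] (β t))
    (hξm : ∀ t, Measurable[ℱ (t + 1)] (ξ t)) (hξ2 : ∀ t, MemLp (ξ t) 2 μ)
    (h0 : ∀ t, μ[ξ t | ℱ t] =ᵐ[μ] 0) {C : ℝ}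
    (hC : ∀ t, μ[fun ω => ξ t ω ^ 2 | ℱ t] ≤ᵐ[μ] fun _ => C)
    (hs : ∀ᵐ ω ∂μ, Summable fun t => β t ω ^ 2) :
    ∀ᵐ ω ∂μ, ∃ l, Tendsto (fun n => ∑ t ∈ Finset.range n, β t ω * ξ t ω) atTop (𝓝 l) := by
  classical
  -- Localization: the weights are switched off once the sum of squares, current term included,
  -- exceeds N. This is decided at time t, and on a path whose total is at most N nothing is
  -- changed.
  let b : ℕ → ℕ → Ω → ℝ := fun N t =>
    {ω | ∑ i ∈ Finset.range (t + 1), β i ω ^ 2 ≤ N}.indicator (β t)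
  have hb : ∀ N t, Measurable[ℱ t] (b N t) := fun N t => by
    refine (hβ t).indicator (measurableSet_le (Finset.measurable_sum _ fun i hi => ?_)
      measurable_const)
    exact ((hβ i).mono (ℱ.mono (Nat.lt_succ_iff.1 (Finset.mem_range.1 hi))) le_rfl).pow_const 2
  have hbN : ∀ (N n : ℕ) (ω : Ω), ∑ t ∈ Finset.range n, b N t ω ^ 2 ≤ N := by
    intro N n ω
    induction n with
    | zero => simp
    | succ n ih =>
      by_cases h : ∑ i ∈ Finset.range (n + 1), β i ω ^ 2 ≤ N
      · refine le_trans (Finset.sum_le_sum fun t _ => ?_) h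
        by_cases h' : ω ∈ {ω | ∑ i ∈ Finset.range (t + 1), β i ω ^ 2 ≤ (N : ℝ)}
        · simp only [b, Set.indicator_of_mem h']; exact le_rfl
        · simp only [b, Set.indicator_of_notMem h']; simpa using sq_nonneg (β t ω)
      · have h' : ω ∉ {ω | ∑ i ∈ Finset.range (n + 1), β i ω ^ 2 ≤ (N : ℝ)} := h
        rw [Finset.sum_range_succ]
        simpa only [b, Set.indicator_of_notMem h', ne_eq, OfNat.ofNat_ne_zero, not_false_eq_true,
          zero_pow, add_zero] using ih
  have hall := ae_all_iff.2 fun N : ℕ =>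
    ae_exists_tendsto_sum_of_sum_sq_le (hb N) hξm hξ2 h0 hC (hbN N)
  filter_upwards [hall, hs] with ω hω hsω
  obtain ⟨N, hN⟩ := exists_nat_ge (∑' t, β t ω ^ 2)
  have hbe : ∀ t, b N t ω = β t ω := fun t => by
    refine Set.indicator_of_mem ?_ _
    exact (hsω.sum_le_tsum _ fun i _ => sq_nonneg _).trans hN
  simpa only [hbe] using hω N

end Martingale

/-! ### The noise of a run: outcomes and coin -/

namespace Run

variable {S A : Type*} [MeasurableSpace S] [Fintype A] [MeasurableSpace A] {M : MDP S A}
  {Ω : Type*} [MeasurableSpace Ω] {μ : Measure Ω}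

/-- The next state and the reward produced at step `t`. -/
def outcome (X : Run M μ) (t : ℕ) (ω : Ω) : S × ℝ := (X.state (t + 1) ω, X.reward t ω)

/-- The event that the pair `(s, a)` is sampled at step `t`. -/
def visit (X : Run M μ) (s : S) (a : A) (t : ℕ) : Set Ω :=
  {ω | X.state t ω = s ∧ X.action t ω = a}

/-- The event that the pair `(s, a)` is sampled at step `t` and the coin shows `c`. -/
def visitCoin (X : Run M μ) (s : S) (a : A) (c : Bool) (t : ℕ) : Set Ω :=
  X.visit s a t ∩ {ω | X.updA t ω = c}

/-- The Robbins–Monro conditions on the learning rates. -/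
def RobbinsMonro (X : Run M μ) : Prop :=
  ∀ᵐ ω ∂μ, ∀ s a,
    (∀ t, 0 ≤ X.α t ω s a ∧ X.α t ω s a ≤ 1) ∧
    Tendsto (fun n => ∑ t ∈ Finset.range n, X.α t ω s a) atTop atTop ∧
    Summable (fun t => X.α t ω s a ^ 2) ∧
    (∀ t, ¬ (s = X.state t ω ∧ a = X.action t ω) → X.α t ω s a = 0)

section Noise

variable (X : Run M μ)

theorem measurable_outcome (t : ℕ) : Measurable[X.ℱ (t + 1)] (X.outcome t) :=
  (X.state_meas (t + 1)).prodMk (X.reward_meas t)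

variable [Countable S] [DiscreteMeasurableSpace S] [DiscreteMeasurableSpace A]

theorem measurableSet_visit (s : S) (a : A) (t : ℕ) : MeasurableSet[X.ℱ t] (X.visit s a t) :=
  (X.state_meas t (measurableSet_singleton s)).inter (X.action_meas t (measurableSet_singleton a))

theorem measurableSet_visitCoin (s : S) (a : A) (c : Bool) (t : ℕ) :
    MeasurableSet[X.ℱ (t + 1)] (X.visitCoin s a c t) :=
  (X.ℱ.mono t.le_succ _ (X.measurableSet_visit s a t)).inter
    (X.updA_meas t (measurableSet_singleton c))

-- This is `step_law` as an identity of measures: on a past event, a visit and one face of the coin,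
-- the outcome keeps its law up to mass. The integrals and conditional expectations of the noise are
-- computed from it.
omit [Countable S] [DiscreteMeasurableSpace S] [DiscreteMeasurableSpace A] in
theorem map_outcome (s : S) (a : A) (c : Bool) (t : ℕ) {E : Set Ω} (hE : MeasurableSet[X.ℱ t] E) :
    (μ.restrict (E ∩ X.visitCoin s a c t)).map (X.outcome t)
      = (2⁻¹ * μ (E ∩ X.visit s a t)) • M.law s a := by
  have hm := (X.measurable_outcome t).mono (X.ℱ.le _) le_rfl
  ext B hB
  rw [Measure.map_apply hm hB, Measure.restrict_apply (hm hB), Measure.smul_apply, smul_eq_mul]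
  have h := X.step_law t s a E hE B hB c
  rw [show X.outcome t ⁻¹' B ∩ (E ∩ X.visitCoin s a c t)
      = E ∩ {ω | X.state t ω = s ∧ X.action t ω = a} ∩
          {ω | X.updA t ω = c ∧ (X.state (t + 1) ω, X.reward t ω) ∈ B} by
    ext ω
    simp only [outcome, visitCoin, visit, Set.mem_inter_iff, Set.mem_preimage, Set.mem_ofPred_eq]
    tauto, h, visit]
  ring

/-- A function of the outcome of step `t`, restricted to the event that `(s, a)` is sampled and
the coin shows `c`. -/
noncomputable def coinNoise (s : S) (a : A) (c : Bool) (g : S × ℝ → ℝ) (t : ℕ) : Ω → ℝ :=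
  (X.visitCoin s a c t).indicator (fun ω => g (X.outcome t ω))

theorem measurable_coinNoise (s : S) (a : A) (c : Bool) {g : S × ℝ → ℝ} (hg : Measurable g)
    (t : ℕ) : Measurable[X.ℱ (t + 1)] (X.coinNoise s a c g t) :=
  (hg.comp (X.measurable_outcome t)).indicator (X.measurableSet_visitCoin s a c t)

omit [Countable S] [DiscreteMeasurableSpace S] [DiscreteMeasurableSpace A] in
theorem coinNoise_sq (s : S) (a : A) (c : Bool) (g : S × ℝ → ℝ) (t : ℕ) (ω : Ω) :
    X.coinNoise s a c g t ω ^ 2 = X.coinNoise s a c (fun p => g p ^ 2) t ω := by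
  by_cases h : ω ∈ X.visitCoin s a c t <;> simp [coinNoise, h]

variable {g : S × ℝ → ℝ}

theorem setIntegral_coinNoise (s : S) (a : A) (c : Bool) (hg : Measurable g) (t : ℕ)
    {E : Set Ω} (hE : MeasurableSet[X.ℱ t] E) :
    ∫ ω in E, X.coinNoise s a c g t ω ∂μ
      = μ.real (E ∩ X.visit s a t) * (2⁻¹ * ∫ p, g p ∂(M.law s a)) := by
  have hm := (X.measurable_outcome t).mono (X.ℱ.le _) le_rfl
  rw [coinNoise, setIntegral_indicator (X.ℱ.le _ _ (X.measurableSet_visitCoin s a c t)),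
    ← integral_map hm.aemeasurable hg.aestronglyMeasurable, X.map_outcome s a c t hE,
    integral_smul_measure, ENNReal.toReal_mul, smul_eq_mul, Measure.real]
  simp
  ring

variable [IsProbabilityMeasure μ]

omit [Countable S] [DiscreteMeasurableSpace S] [DiscreteMeasurableSpace A] in
theorem integrableOn_outcome {s : S} {a : A} (c : Bool) (hi : Integrable g (M.law s a)) (t : ℕ) :
    IntegrableOn (fun ω => g (X.outcome t ω)) (X.visitCoin s a c t) μ := by
  have hm := (X.measurable_outcome t).mono (X.ℱ.le _) le_rfl
  have h := X.map_outcome s a c t MeasurableSet.univ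
  rw [Set.univ_inter, Set.univ_inter] at h
  have hi' : Integrable g ((μ.restrict (X.visitCoin s a c t)).map (X.outcome t)) := by
    rw [h]
    exact hi.smul_measure (ENNReal.mul_ne_top (by simp) (measure_ne_top _ _))
  exact hi'.comp_measurable hm

theorem integrable_coinNoise {s : S} {a : A} (c : Bool) (hi : Integrable g (M.law s a)) (t : ℕ) :
    Integrable (X.coinNoise s a c g t) μ :=
  (integrable_indicator_iff (X.ℱ.le _ _ (X.measurableSet_visitCoin s a c t))).2
    (X.integrableOn_outcome c hi t)

theorem condExp_coinNoise {s : S} {a : A} (c : Bool) (hg : Measurable g)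
    (hi : Integrable g (M.law s a)) (t : ℕ) :
    μ[X.coinNoise s a c g t | X.ℱ t]
      =ᵐ[μ] (X.visit s a t).indicator fun _ => 2⁻¹ * ∫ p, g p ∂(M.law s a) := by
  have hv := X.measurableSet_visit s a t
  refine (ae_eq_condExp_of_forall_setIntegral_eq (X.ℱ.le t) (X.integrable_coinNoise c hi t)
    (fun E _ _ => ((integrable_const _).indicator (X.ℱ.le t _ hv)).integrableOn)
    (fun E hE _ => ?_)
    ((measurable_const.indicator hv).stronglyMeasurable.aestronglyMeasurable)).symm
  rw [X.setIntegral_coinNoise s a c hg t hE, setIntegral_indicator (X.ℱ.le t _ hv),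
    setIntegral_const, smul_eq_mul]

theorem memLp_coinNoise {s : S} {a : A} (c : Bool) (hg : Measurable g)
    (h2 : MemLp g 2 (M.law s a)) (t : ℕ) : MemLp (X.coinNoise s a c g t) 2 μ := by
  rw [memLp_two_iff_integrable_sq
    ((X.measurable_coinNoise s a c hg t).mono (X.ℱ.le _) le_rfl).aestronglyMeasurable]
  simp only [coinNoise_sq]
  exact X.integrable_coinNoise c h2.integrable_sq t

/-- Weighted sums of the centered noise produced at the visits of a pair `(s, a)` converge. -/
theorem ae_exists_tendsto_sum_noise (hα : X.RobbinsMonro) {s : S} {a : A} (w : Bool → ℝ)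
    (hg : Measurable g) (h2 : MemLp g 2 (M.law s a))
    (h0 : (w true + w false) * ∫ p, g p ∂(M.law s a) = 0) {b : ℕ → Ω → ℝ}
    (hb : ∀ t, Measurable[X.ℱ t] (b t)) (hbb : ∀ᵐ ω ∂μ, ∃ B, ∀ t, |b t ω| ≤ B) :
    ∀ᵐ ω ∂μ, ∃ l, Tendsto (fun n => ∑ t ∈ Finset.range n,
      X.α t ω s a * b t ω * (w (X.updA t ω) * g (X.outcome t ω))) atTop (𝓝 l) := by
  have := M.law_prob s a
  have hgi : Integrable g (M.law s a) := h2.integrable (by norm_num)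
  -- There are two ways to satisfy `h0`: either `g` has mean zero, or the two faces of the coin
  -- carry opposite weights and `g` is arbitrary.
  let ξ : ℕ → Ω → ℝ := fun t => w true • X.coinNoise s a true g t +
    w false • X.coinNoise s a false g t
  have hξm : ∀ t, Measurable[X.ℱ (t + 1)] (ξ t) := fun t =>
    ((X.measurable_coinNoise s a true hg t).const_smul _).add
      ((X.measurable_coinNoise s a false hg t).const_smul _)
  have hξ2 : ∀ t, MemLp (ξ t) 2 μ := fun t =>
    ((X.memLp_coinNoise true hg h2 t).const_smul _).add
      ((X.memLp_coinNoise false hg h2 t).const_smul _)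
  have hce : ∀ (w : Bool → ℝ) {g : S × ℝ → ℝ}, Measurable g → Integrable g (M.law s a) → ∀ t,
      μ[w true • X.coinNoise s a true g t + w false • X.coinNoise s a false g t | X.ℱ t] =ᵐ[μ]
        (X.visit s a t).indicator fun _ =>
          2⁻¹ * ((w true + w false) * ∫ p, g p ∂(M.law s a)) := by
    intro w g hg hgi t
    have e1 := condExp_add ((X.integrable_coinNoise true hgi t).smul (w true))
      ((X.integrable_coinNoise false hgi t).smul (w false)) (X.ℱ t)
    have e2 := condExp_smul (μ := μ) (w true) (X.coinNoise s a true g t) (X.ℱ t)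
    have e3 := condExp_smul (μ := μ) (w false) (X.coinNoise s a false g t) (X.ℱ t)
    filter_upwards [e1, e2, e3, X.condExp_coinNoise true hg hgi t,
      X.condExp_coinNoise false hg hgi t] with ω e1 e2 e3 e4 e5
    rw [e1, Pi.add_apply, e2, e3, Pi.smul_apply, Pi.smul_apply, e4, e5]
    by_cases h : ω ∈ X.visit s a t
    · simp only [Set.indicator_of_mem h, smul_eq_mul]; ring
    · simp [Set.indicator_of_notMem h]
  have hsq : ∀ t, (fun ω => ξ t ω ^ 2) = w true ^ 2 • X.coinNoise s a true (fun p => g p ^ 2) t +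
      w false ^ 2 • X.coinNoise s a false (fun p => g p ^ 2) t := by
    intro t
    ext ω
    simp only [ξ, Pi.add_apply, Pi.smul_apply, smul_eq_mul, ← coinNoise_sq]
    -- The coin shows only one face, so the two parts of `ξ` are never both nonzero.
    have : X.coinNoise s a true g t ω * X.coinNoise s a false g t ω = 0 := by
      by_cases h : X.updA t ω = true <;> simp [coinNoise, visitCoin, h]
    linear_combination 2 * w true * w false * this
  have hmain := ae_exists_tendsto_sum_of_summable_sq (μ := μ) (ℱ := X.ℱ) (ξ := ξ)
    (β := fun t ω => X.α t ω s a * b t ω)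
    (C := 2⁻¹ * ((w true ^ 2 + w false ^ 2) * ∫ p, g p ^ 2 ∂(M.law s a)))
    (fun t => (X.α_meas t s a).mul (hb t)) hξm hξ2
    (fun t => by
      filter_upwards [hce w hg hgi t] with ω hω
      refine hω.trans ?_
      simp [h0])
    (fun t => by
      rw [hsq]
      filter_upwards [hce (fun c => w c ^ 2) (hg.pow_const 2) h2.integrable_sq t] with ω hω
      refine hω.le.trans (Set.indicator_apply_le' (fun _ => le_rfl) fun _ => ?_)
      have : 0 ≤ ∫ p, g p ^ 2 ∂(M.law s a) := integral_nonneg fun p => sq_nonneg _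
      positivity)
    (by
      filter_upwards [hα, hbb] with ω hω ⟨B, hB⟩
      refine Summable.of_nonneg_of_le (fun t => sq_nonneg _) (fun t => ?_)
        ((hω s a).2.2.1.mul_right (B ^ 2))
      rw [mul_pow]
      exact mul_le_mul_of_nonneg_left (sq_le_sq' (abs_le.1 (hB t)).1 (abs_le.1 (hB t)).2)
        (sq_nonneg _))
  filter_upwards [hmain, hα] with ω hω hαω
  refine hω.imp fun l hl => hl.congr fun n => Finset.sum_congr rfl fun t _ => ?_
  by_cases hv : ω ∈ X.visit s a t
  · cases hc : X.updA t ω <;> simp [ξ, coinNoise, visitCoin, hv, hc]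
  · have : X.α t ω s a = 0 :=
      (hαω s a).2.2.2 t fun h => hv ⟨h.1.symm, h.2.symm⟩
    simp [this]

/-- The learning rates at the steps at which a given table is updated are not summable. -/
theorem ae_tendsto_sum_updA (hα : X.RobbinsMonro) (s : S) (a : A) :
    ∀ᵐ ω ∂μ, Tendsto (fun n => ∑ t ∈ Finset.range n,
      X.α t ω s a * (if X.updA t ω then 1 else 0)) atTop atTop := by
  have := M.law_prob s a
  have h := X.ae_exists_tendsto_sum_noise hα (s := s) (a := a) (g := fun _ => 1)
    (fun c => if c then 1 / 2 else -(1 / 2)) measurable_const (memLp_const _) (by simp)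
    (b := fun _ _ => 1) (fun _ => measurable_const) (Eventually.of_forall fun _ => ⟨1, by simp⟩)
  filter_upwards [h, hα] with ω ⟨l, hl⟩ hω
  -- The indicator of an update of Q^A is 1/2 plus the coin sign times 1/2: half the divergent rate
  -- sum plus a convergent series.
  refine (((hω s a).2.1.atTop_mul_const (show (0 : ℝ) < 1 / 2 by norm_num)).atTop_add hl).congr
    fun n => ?_
  rw [Finset.sum_mul, ← Finset.sum_add_distrib]
  refine Finset.sum_congr rfl fun t _ => ?_
  cases X.updA t ω
  · simp
  · simp; ring

end Noise

end Run

/-! ### Bellman equations and optimality of greedy policies -/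

section Optimality

variable {S A : Type*} [Fintype S] [MeasurableSpace S] [DiscreteMeasurableSpace S] [Fintype A]

namespace MDP

variable (M : MDP S A)

omit [Fintype S] [DiscreteMeasurableSpace S] [Fintype A] in
theorem trans_nonneg (s : S) (a : A) (s' : S) : 0 ≤ M.trans s a s' := measureReal_nonneg

omit [Fintype A] in
theorem sum_trans (s : S) (a : A) : ∑ s', M.trans s a s' = 1 := by
  have := M.law_prob s a
  have h := sum_measureReal_preimage_singleton (μ := M.law s a) (Finset.univ : Finset S)
    (f := Prod.fst) (fun y _ => measurable_fst (measurableSet_singleton y))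
  have h2 : (Prod.fst : S × ℝ → S) ⁻¹' ((Finset.univ : Finset S) : Set S) = Set.univ := by simp
  rw [h2, probReal_univ] at h
  exact h

omit [Fintype A] in
theorem sum_trans_mul_le {f : S → ℝ} {B : ℝ} (h : ∀ s', f s' ≤ B) (s : S) (a : A) :
    ∑ s', M.trans s a s' * f s' ≤ B := by
  calc ∑ s', M.trans s a s' * f s' ≤ ∑ s', M.trans s a s' * B :=
        Finset.sum_le_sum fun s' _ => mul_le_mul_of_nonneg_left (h s') (M.trans_nonneg s a s')
    _ = B := by rw [← Finset.sum_mul, M.sum_trans, one_mul]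

omit [Fintype A] in
theorem abs_sum_trans_mul_le {f : S → ℝ} {B : ℝ} (h : ∀ s', |f s'| ≤ B) (s : S) (a : A) :
    |∑ s', M.trans s a s' * f s'| ≤ B := by
  refine abs_le.2 ⟨?_, M.sum_trans_mul_le (fun s' => (abs_le.1 (h s')).2) s a⟩
  have := M.sum_trans_mul_le (f := fun s' => -f s') (fun s' => neg_le.1 (abs_le.1 (h s')).1) s a
  simp only [mul_neg, Finset.sum_neg_distrib] at this
  linarith

/-- The Bellman optimality operator. -/
noncomputable def bellman (Q : S → A → ℝ) : S → A → ℝ := fun s a =>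
  M.meanReward s a + M.γ * ∑ s', M.trans s a s' * ⨆ a', Q s' a'

theorem existsUnique_isOptimalQ [Nonempty A] (h0 : 0 ≤ M.γ) (h1 : M.γ < 1) :
    ∃! Q : S → A → ℝ, M.IsOptimalQ Q := by
  have hlip : LipschitzWith ⟨M.γ, h0⟩ M.bellman := by
    refine LipschitzWith.of_dist_le_mul fun Q Q' => ?_
    have hr : 0 ≤ M.γ * dist Q Q' := mul_nonneg h0 dist_nonneg
    refine (dist_pi_le_iff hr).2 fun s => (dist_pi_le_iff hr).2 fun a => ?_
    have h := M.abs_sum_trans_mul_le (f := fun s' => (⨆ a', Q s' a') - ⨆ a', Q' s' a')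
      (B := dist Q Q') (fun s' => abs_iSup_sub_iSup_le fun a' => by
        rw [← Real.dist_eq]
        exact (dist_le_pi_dist (Q s') (Q' s') a').trans (dist_le_pi_dist Q Q' s')) s a
    simp only [mul_sub, Finset.sum_sub_distrib] at h
    rw [Real.dist_eq, bellman, bellman, add_sub_add_left_eq_sub, ← mul_sub, abs_mul,
      abs_of_nonneg h0]
    exact mul_le_mul_of_nonneg_left h h0
  have hc : ContractingWith ⟨M.γ, h0⟩ M.bellman := ⟨h1, hlip⟩
  have hiff : ∀ Q, M.IsOptimalQ Q ↔ Function.IsFixedPt M.bellman Q := fun Q =>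
    ⟨fun h => funext₂ fun s a => (h s a).symm, fun h s a => (congrFun₂ h s a).symm⟩
  refine ⟨hc.fixedPoint, (hiff _).2 hc.fixedPoint_isFixedPt, fun Q hQ => ?_⟩
  exact hc.fixedPoint_unique ((hiff Q).1 hQ)

end MDP

omit [Fintype S] [MeasurableSpace S] [DiscreteMeasurableSpace S] in
theorem Policy.sum_prob_mul_le (π : Policy S A) {f : A → ℝ} {B : ℝ} (h : ∀ a, f a ≤ B) (s : S) :
    ∑ a, π.prob s a * f a ≤ B := by
  calc ∑ a, π.prob s a * f a ≤ ∑ a, π.prob s a * B :=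
        Finset.sum_le_sum fun a _ => mul_le_mul_of_nonneg_left (h a) (π.nonneg s a)
    _ = B := by rw [← Finset.sum_mul, π.sum_eq_one, one_mul]

omit [Fintype S] [MeasurableSpace S] [DiscreteMeasurableSpace S] in
theorem Policy.IsGreedy.sum_prob_mul [Nonempty A] {π : Policy S A} {q : S → A → ℝ}
    (h : π.IsGreedy q) (s : S) : ∑ a, π.prob s a * q s a = ⨆ a, q s a := by
  have h1 : ∀ a, π.prob s a * q s a = π.prob s a * ⨆ a, q s a := fun a => by
    rcases (π.nonneg s a).eq_or_lt with h0 | h0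
    · simp [← h0]
    · congr 1
      exact le_antisymm (le_ciSup (Set.finite_range (q s)).bddAbove a) (ciSup_le (h s a h0))
  rw [Finset.sum_congr rfl fun a _ => h1 a, ← Finset.sum_mul, π.sum_eq_one, one_mul]

namespace MDP

variable (M : MDP S A)

theorem exists_bound_stepReward (π : Policy S A) : ∃ B, ∀ n s a, |M.stepReward π n s a| ≤ B := by
  obtain ⟨B, hB⟩ := (Set.finite_range fun x : S × A => |M.meanReward x.1 x.2|).bddAbove
  refine ⟨B, fun n => ?_⟩
  induction n with
  | zero => exact fun s a => hB ⟨(s, a), rfl⟩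
  | succ n ih =>
    refine M.abs_sum_trans_mul_le fun s' => abs_le.2 ⟨?_, ?_⟩
    · have := π.sum_prob_mul_le (f := fun a => -M.stepReward π n s' a)
        (fun a => neg_le.1 (abs_le.1 (ih s' a)).1) s'
      simp only [mul_neg, Finset.sum_neg_distrib] at this
      linarith
    · exact π.sum_prob_mul_le (fun a => (abs_le.1 (ih s' a)).2) s'

theorem summable_stepReward (h0 : 0 ≤ M.γ) (h1 : M.γ < 1) (π : Policy S A) (s : S) (a : A) :
    Summable fun n => M.γ ^ n * M.stepReward π n s a := by
  obtain ⟨B, hB⟩ := M.exists_bound_stepReward π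
  refine Summable.of_norm_bounded ((summable_geometric_of_lt_one h0 h1).mul_right B) fun n => ?_
  rw [norm_mul, Real.norm_of_nonneg (pow_nonneg h0 n)]
  exact mul_le_mul_of_nonneg_left (hB n s a) (pow_nonneg h0 n)

/-- The Bellman equation of a policy. -/
theorem qValue_eq (h0 : 0 ≤ M.γ) (h1 : M.γ < 1) (π : Policy S A) (s : S) (a : A) :
    M.qValue π s a = M.meanReward s a
      + M.γ * ∑ s', M.trans s a s' * ∑ a', π.prob s' a' * M.qValue π s' a' := by
  have hs := M.summable_stepReward h0 h1 π
  rw [qValue, (hs s a).tsum_eq_zero_add, pow_zero, one_mul]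
  congr 1
  have h : HasSum (fun n => M.γ * ∑ s', M.trans s a s' *
      ∑ a', π.prob s' a' * (M.γ ^ n * M.stepReward π n s' a'))
      (M.γ * ∑ s', M.trans s a s' * ∑ a', π.prob s' a' * M.qValue π s' a') :=
    (hasSum_sum fun s' _ => (hasSum_sum fun a' _ =>
      (hs s' a').hasSum.mul_left _).mul_left _).mul_left _
  rw [← h.tsum_eq]
  refine tsum_congr fun n => ?_
  rw [stepReward, pow_succ', mul_assoc]
  congr 1
  simp only [Finset.mul_sum]
  refine Finset.sum_congr rfl fun s' _ => Finset.sum_congr rfl fun a' _ => ?_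
  ring

/-- Maximum principle: where the difference of the two action-value functions attains its maximum D,
the two Bellman equations give D ≤ γD, so D > 0 is impossible. One direction holds for every policy,
the other uses greediness. -/
theorem isOptimalPolicy_of_isGreedy [Nonempty A] (h0 : 0 ≤ M.γ) (h1 : M.γ < 1)
    {Q : S → A → ℝ} (hQ : M.IsOptimalQ Q) {π : Policy S A} (hπ : π.IsGreedy Q) :
    M.IsOptimalPolicy π := by
  have hle : ∀ (π' : Policy S A) s a, M.qValue π' s a ≤ Q s a := by
    intro π'
    by_contra! hcon
    obtain ⟨s₀, a₀, hlt⟩ := hcon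
    have : Nonempty (S × A) := ⟨(s₀, a₀)⟩
    obtain ⟨x, hx⟩ := Finite.exists_max fun x : S × A => M.qValue π' x.1 x.2 - Q x.1 x.2
    set D := M.qValue π' x.1 x.2 - Q x.1 x.2 with hD
    have hD0 : 0 < D := by have := hx (s₀, a₀); simp only at this; linarith
    have hs : ∀ s', (∑ a', π'.prob s' a' * M.qValue π' s' a') - ⨆ a', Q s' a' ≤ D := by
      intro s'
      have := π'.sum_prob_mul_le (f := fun a' => M.qValue π' s' a') (B := D + ⨆ a', Q s' a')
        (fun a' => by
          have h1 := hx (s', a')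
          have h2 := le_ciSup (Set.finite_range (Q s')).bddAbove a'
          simp only at h1
          linarith) s'
      linarith
    have h2 := M.sum_trans_mul_le hs x.1 x.2
    simp only [mul_sub, Finset.sum_sub_distrib] at h2
    have h3 := M.qValue_eq h0 h1 π' x.1 x.2
    have h4 := hQ x.1 x.2
    have h5 : D ≤ M.γ * D := by
      linarith [mul_le_mul_of_nonneg_left h2 h0]
    nlinarith
  have hge : ∀ s a, Q s a ≤ M.qValue π s a := by
    by_contra! hcon
    obtain ⟨s₀, a₀, hlt⟩ := hcon
    have : Nonempty (S × A) := ⟨(s₀, a₀)⟩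
    obtain ⟨x, hx⟩ := Finite.exists_max fun x : S × A => Q x.1 x.2 - M.qValue π x.1 x.2
    set D := Q x.1 x.2 - M.qValue π x.1 x.2 with hD
    have hD0 : 0 < D := by have := hx (s₀, a₀); simp only at this; linarith
    have hs : ∀ s', (⨆ a', Q s' a') - ∑ a', π.prob s' a' * M.qValue π s' a' ≤ D := by
      intro s'
      rw [← hπ.sum_prob_mul, ← Finset.sum_sub_distrib]
      simp only [← mul_sub]
      exact π.sum_prob_mul_le (fun a' => hx (s', a')) s'
    have h2 := M.sum_trans_mul_le hs x.1 x.2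
    simp only [mul_sub, Finset.sum_sub_distrib] at h2
    have h3 := M.qValue_eq h0 h1 π x.1 x.2
    have h4 := hQ x.1 x.2
    have h5 : D ≤ M.γ * D := by
      linarith [mul_le_mul_of_nonneg_left h2 h0]
    nlinarith
  intro π' s
  calc M.value π' s ≤ ⨆ a, Q s a := π'.sum_prob_mul_le (fun a =>
        (hle π' s a).trans (le_ciSup (Set.finite_range (Q s)).bddAbove a)) s
    _ = ∑ a, π.prob s a * Q s a := (hπ.sum_prob_mul s).symm
    _ ≤ M.value π s := Finset.sum_le_sum fun a _ =>
        mul_le_mul_of_nonneg_left (hge s a) (π.nonneg s a)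

end MDP

-- Each strict inequality between two entries of a row of `Q` eventually holds for `q t`, and there
-- are finitely many; so an action that is suboptimal for `Q` cannot stay maximal for `q t`.
omit [MeasurableSpace S] [DiscreteMeasurableSpace S] in
theorem eventually_isGreedy_imp {q : ℕ → S → A → ℝ} {Q : S → A → ℝ}
    (h : ∀ s a, Tendsto (fun t => q t s a) atTop (𝓝 (Q s a))) :
    ∀ᶠ t in atTop, ∀ π : Policy S A, π.IsGreedy (q t) → π.IsGreedy Q := by
  have h1 : ∀ᶠ t in atTop, ∀ s a b, Q s a < Q s b → q t s a < q t s b := by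
    simp only [eventually_all]
    exact fun s a b hab => (h s a).eventually_lt (h s b) hab
  filter_upwards [h1] with t ht π hπ s a ha b
  exact not_lt.1 fun hab => (ht s a b hab).not_ge (hπ s a ha b)

end Optimality

/-! ### Pathwise recursions and bounds on the clipped value -/

namespace Run

section Paths

variable {S A : Type*} [MeasurableSpace S] [Fintype A] [MeasurableSpace A] {M : MDP S A}
  {Ω : Type*} [MeasurableSpace Ω] {μ : Measure Ω} (X : Run M μ)

/-- The run with the two tables exchanged. -/
def swap : Run M μ where
  ℱ := X.ℱ
  state := X.state
  action := X.action
  reward := X.reward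
  α := X.α
  updA := fun t ω => !X.updA t ω
  K := X.K
  cand := X.cand
  aK := X.aK
  QA := X.QB
  QB := X.QA
  state_meas := X.state_meas
  action_meas := X.action_meas
  α_meas := X.α_meas
  QA_meas := X.QB_meas
  QB_meas := X.QA_meas
  reward_meas := X.reward_meas
  updA_meas := fun t => (measurable_of_finite Bool.not).comp (X.updA_meas t)
  K_meas := X.K_meas
  aK_meas := X.aK_meas
  step_law := fun t s a E hE B hB c => by
    rw [← X.step_law t s a E hE B hB (!c)]
    simp only [Bool.not_eq_eq_eq_not]
  K_range := X.K_range
  stepA := fun t ω h => X.stepB t ω (by simpa using h)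
  stepB := fun t ω h => X.stepA t ω (by simpa using h)

/-- The clipped estimate of the value of the next state used at step `t`. -/
noncomputable def clippedValue (t : ℕ) (ω : Ω) : ℝ :=
  if X.updA t ω then
    min (X.QB t ω (X.state (t + 1) ω) (X.aK t ω)) (⨆ a, X.QA t ω (X.state (t + 1) ω) a)
  else
    min (X.QA t ω (X.state (t + 1) ω) (X.aK t ω)) (⨆ a, X.QB t ω (X.state (t + 1) ω) a)

/-- The sup distance between the two tables. -/
noncomputable def gap (t : ℕ) (ω : Ω) : ℝ :=
  ⨆ x : S × A, |X.QA t ω x.1 x.2 - X.QB t ω x.1 x.2|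

/-- The smaller one of the values that the two tables assign to a state. -/
noncomputable def minValue (t : ℕ) (ω : Ω) (s : S) : ℝ :=
  min (⨆ a, X.QA t ω s a) (⨆ a, X.QB t ω s a)

/-- Because the rate vanishes off the sampled pair, one recursion covers every entry at every step,
as the contraction scheme requires. -/
theorem QA_succ {t : ℕ} {ω : Ω} {s : S} {a : A}
    (h : ¬ (s = X.state t ω ∧ a = X.action t ω) → X.α t ω s a = 0) :
    X.QA (t + 1) ω s a = X.QA t ω s a + X.α t ω s a * (if X.updA t ω then 1 else 0) *
      (X.reward t ω + M.γ * X.clippedValue t ω - X.QA t ω s a) := by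
  cases hu : X.updA t ω
  · simp [(X.stepB t ω hu).2.2.2]
  · rw [(X.stepA t ω hu).2.2.1, updateEntry]
    by_cases hx : s = X.state t ω ∧ a = X.action t ω
    · obtain ⟨rfl, rfl⟩ := hx
      simp [clippedValue, target, hu]
    · simp [hx, h hx]

theorem QB_succ {t : ℕ} {ω : Ω} {s : S} {a : A}
    (h : ¬ (s = X.state t ω ∧ a = X.action t ω) → X.α t ω s a = 0) :
    X.QB (t + 1) ω s a = X.QB t ω s a + X.α t ω s a * (if X.updA t ω then 0 else 1) *
      (X.reward t ω + M.γ * X.clippedValue t ω - X.QB t ω s a) := by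
  have := X.swap.QA_succ (t := t) (ω := ω) (s := s) (a := a) h
  cases hu : X.updA t ω <;> simpa [swap, clippedValue, hu] using this

theorem abs_clippedValue_le {t : ℕ} {ω : Ω} {B : ℝ} (hA : ∀ s a, |X.QA t ω s a| ≤ B)
    (hB : ∀ s a, |X.QB t ω s a| ≤ B) : |X.clippedValue t ω| ≤ B := by
  have : Nonempty A := ⟨X.action t ω⟩
  rw [clippedValue]
  split_ifs
  · exact abs_min_le_max_abs_abs.trans (max_le (hB _ _) (abs_iSup_le (hA _)))
  · exact abs_min_le_max_abs_abs.trans (max_le (hA _ _) (abs_iSup_le (hB _)))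

theorem abs_minValue_le [Nonempty A] {t : ℕ} {ω : Ω} {B : ℝ} (hA : ∀ s a, |X.QA t ω s a| ≤ B)
    (hB : ∀ s a, |X.QB t ω s a| ≤ B) (s : S) : |X.minValue t ω s| ≤ B :=
  abs_min_le_max_abs_abs.trans (max_le (abs_iSup_le (hA s)) (abs_iSup_le (hB s)))

section Gap

variable [Finite S]

theorem abs_sub_le_gap (t : ℕ) (ω : Ω) (s : S) (a : A) :
    |X.QA t ω s a - X.QB t ω s a| ≤ X.gap t ω :=
  le_ciSup (f := fun x : S × A => |X.QA t ω x.1 x.2 - X.QB t ω x.1 x.2|)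
    (Set.finite_range _).bddAbove (s, a)

omit [Finite S] in
theorem gap_le {t : ℕ} {ω : Ω} {B : ℝ} (h : ∀ s a, |X.QA t ω s a - X.QB t ω s a| ≤ B) :
    X.gap t ω ≤ B := by
  have : Nonempty (S × A) := ⟨(X.state t ω, X.action t ω)⟩
  exact ciSup_le fun x => h x.1 x.2

theorem gap_nonneg (t : ℕ) (ω : Ω) : 0 ≤ X.gap t ω :=
  (abs_nonneg _).trans (X.abs_sub_le_gap t ω (X.state t ω) (X.action t ω))

theorem iSup_QA_sub_gap_le_clippedValue {t : ℕ} {ω : Ω} (hu : X.updA t ω = true) :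
    (⨆ a, X.QA t ω (X.state (t + 1) ω) a) - X.gap t ω ≤ X.clippedValue t ω := by
  have : Nonempty A := ⟨X.action t ω⟩
  obtain ⟨h1, h2, -⟩ := X.stepA t ω hu
  rw [clippedValue, if_pos hu]
  exact iSup_sub_le_of_isTopK h1 h2 (X.abs_sub_le_gap t ω _)

theorem iSup_QB_sub_gap_le_clippedValue {t : ℕ} {ω : Ω} (hu : X.updA t ω = false) :
    (⨆ a, X.QB t ω (X.state (t + 1) ω) a) - X.gap t ω ≤ X.clippedValue t ω := by
  have : Nonempty A := ⟨X.action t ω⟩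
  obtain ⟨h1, h2, -⟩ := X.stepB t ω hu
  rw [clippedValue, if_neg (by simp [hu])]
  exact iSup_sub_le_of_isTopK h1 h2 fun b => by
    rw [abs_sub_comm]; exact X.abs_sub_le_gap t ω _ b

-- The selected entry of the other table is at most that table's maximum. With
-- `minValue_sub_gap_le_clippedValue` this traps the clipped value in an interval of length `gap`
-- whose endpoints, given the next state, do not depend on the coin.
omit [Finite S] in
theorem clippedValue_le_minValue (t : ℕ) (ω : Ω) :
    X.clippedValue t ω ≤ X.minValue t ω (X.state (t + 1) ω) := by
  rw [clippedValue, minValue]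
  split_ifs
  · exact le_min (min_le_right _ _) ((min_le_left _ _).trans
      (le_ciSup (Set.finite_range _).bddAbove _))
  · exact le_min ((min_le_left _ _).trans (le_ciSup (Set.finite_range _).bddAbove _))
      (min_le_right _ _)

theorem minValue_sub_gap_le_clippedValue (t : ℕ) (ω : Ω) :
    X.minValue t ω (X.state (t + 1) ω) - X.gap t ω ≤ X.clippedValue t ω := by
  cases hu : X.updA t ω
  · exact (sub_le_sub_right (min_le_right _ _) _).trans (X.iSup_QB_sub_gap_le_clippedValue hu)
  · exact (sub_le_sub_right (min_le_left _ _) _).trans (X.iSup_QA_sub_gap_le_clippedValue hu)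

theorem measurable_gap (t : ℕ) : Measurable[X.ℱ t] (X.gap t) :=
  Measurable.iSup fun x : S × A =>
    continuous_abs.measurable.comp ((X.QA_meas t x.1 x.2).sub (X.QB_meas t x.1 x.2))

end Gap

theorem measurable_iSup_QA (t : ℕ) (s : S) :
    Measurable[X.ℱ t] (fun ω => ⨆ a, X.QA t ω s a) :=
  Measurable.iSup fun a => X.QA_meas t s a

theorem measurable_minValue (t : ℕ) (s : S) : Measurable[X.ℱ t] (fun ω => X.minValue t ω s) :=
  (X.measurable_iSup_QA t s).min (X.swap.measurable_iSup_QA t s)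

end Paths

/-! ### Boundedness, merging of the tables, and convergence -/

section Convergence

variable {S A : Type*} [Fintype S] [MeasurableSpace S] [DiscreteMeasurableSpace S]
  [Fintype A] [MeasurableSpace A] [DiscreteMeasurableSpace A] {M : MDP S A}
  {Ω : Type*} [MeasurableSpace Ω] {μ : Measure Ω} [IsProbabilityMeasure μ] (X : Run M μ)

open Classical in
theorem measurable_ite_fst_eq (s' : S) (c : ℝ) :
    Measurable (fun p : S × ℝ => if p.1 = s' then c else 0) :=
  Measurable.ite (measurable_fst (measurableSet_singleton s')) measurable_const measurable_const

open Classical in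
theorem memLp_ite_fst_eq (ν : Measure (S × ℝ)) [IsFiniteMeasure ν] (s' : S) (c : ℝ) :
    MemLp (fun p : S × ℝ => if p.1 = s' then c else 0) 2 ν :=
  MemLp.of_bound (measurable_ite_fst_eq s' c).aestronglyMeasurable |c|
    (Eventually.of_forall fun p => by by_cases h : p.1 = s' <;> simp [h])

open Classical in
omit [Fintype A] [MeasurableSpace A] [DiscreteMeasurableSpace A] in
theorem integral_ite_fst_eq (s : S) (a : A) (s' : S) :
    ∫ p, (if p.1 = s' then (1 : ℝ) else 0) ∂(M.law s a) = M.trans s a s' := by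
  have h : (fun p : S × ℝ => if p.1 = s' then (1 : ℝ) else 0)
      = {p : S × ℝ | p.1 = s'}.indicator 1 := by
    ext p; by_cases h : p.1 = s' <;> simp [h]
  rw [h]
  exact integral_indicator_one (measurable_fst (measurableSet_singleton s'))

/-- The tables are almost surely bounded. -/
theorem ae_bounded (hγ0 : 0 ≤ M.γ) (hγ1 : M.γ < 1) (hα : X.RobbinsMonro)
    (hr : ∀ s a, MemLp (fun p : S × ℝ => p.2) 2 (M.law s a)) :
    ∀ᵐ ω ∂μ, ∃ B, ∀ t s a, |X.QA t ω s a| ≤ B ∧ |X.QB t ω s a| ≤ B := by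
  -- Only the reward is centred here. The value of the next state stays in `u`, where a sup bound
  -- suffices; the noise then has constant extra weight 1, and no prior bound on the tables is
  -- needed.
  have hn : ∀ᵐ ω ∂μ, ∀ z : Bool × S × A, ∃ l, Tendsto (fun n => ∑ t ∈ Finset.range n,
      X.α t ω z.2.1 z.2.2 * 1 * ((if X.updA t ω = z.1 then 1 else 0) *
        ((X.outcome t ω).2 - M.meanReward z.2.1 z.2.2))) atTop (𝓝 l) := by
    refine ae_all_iff.2 fun z => ?_
    have := M.law_prob z.2.1 z.2.2
    refine X.ae_exists_tendsto_sum_noise hα (fun c => if c = z.1 then 1 else 0)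
      (g := fun p => p.2 - M.meanReward z.2.1 z.2.2) (measurable_snd.sub_const _)
      ((hr _ _).sub (memLp_const _)) ?_ (fun _ => measurable_const)
      (Eventually.of_forall fun _ => ⟨1, by simp⟩)
    rw [integral_sub ((hr _ _).integrable (by norm_num)) (integrable_const _)]
    simp [MDP.meanReward]
  obtain ⟨C, hC⟩ := (Set.finite_range fun x : S × A => |M.meanReward x.1 x.2|).bddAbove
  filter_upwards [hn, hα] with ω hn hω
  have key := exists_bound_of_contraction (Z := Bool × S × A) (γ := M.γ) (C := C)
    (Δ := fun t z => if z.1 then X.QA t ω z.2.1 z.2.2 else X.QB t ω z.2.1 z.2.2)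
    (a := fun t z => X.α t ω z.2.1 z.2.2 * (if X.updA t ω = z.1 then 1 else 0))
    (u := fun t z => M.meanReward z.2.1 z.2.2 + M.γ * X.clippedValue t ω)
    hγ1 (fun t z => ?_) (fun t z => ?_) hn (fun t z => ?_) (fun t B hB z => ?_)
  · obtain ⟨B, hB⟩ := key
    exact ⟨B, fun t s a => ⟨by simpa using hB t (true, s, a), by simpa using hB t (false, s, a)⟩⟩
  · have := ((hω z.2.1 z.2.2).1 t).1
    split_ifs <;> simp [this]
  · have := ((hω z.2.1 z.2.2).1 t).2
    split_ifs <;> simp [this]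
  · obtain ⟨c, s, a⟩ := z
    have hA := X.QA_succ ((hω s a).2.2.2 t)
    have hB := X.QB_succ ((hω s a).2.2.2 t)
    cases hu : X.updA t ω <;> cases c <;> simp [hu, hA, hB, outcome] <;> ring
  · have h := X.abs_clippedValue_le (t := t) (ω := ω) (B := B)
      (fun s a => by simpa using hB (true, s, a)) (fun s a => by simpa using hB (false, s, a))
    calc |M.meanReward z.2.1 z.2.2 + M.γ * X.clippedValue t ω|
        ≤ |M.meanReward z.2.1 z.2.2| + M.γ * |X.clippedValue t ω| := by
          refine (abs_add_le _ _).trans_eq ?_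
          rw [abs_mul, abs_of_nonneg hγ0]
      _ ≤ C + M.γ * B := add_le_add (hC ⟨z.2, rfl⟩) (mul_le_mul_of_nonneg_left h hγ0)
      _ = M.γ * B + C := add_comm _ _

open Classical in
/-- The two tables almost surely approach each other. -/
theorem ae_tendsto_gap (hγ0 : 0 ≤ M.γ) (hγ1 : M.γ < 1) (hα : X.RobbinsMonro)
    (hr : ∀ s a, MemLp (fun p : S × ℝ => p.2) 2 (M.law s a)) :
    ∀ᵐ ω ∂μ, Tendsto (fun t => X.gap t ω) atTop (𝓝 0) := by
  have hbdd := X.ae_bounded hγ0 hγ1 hα hr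
  -- With opposite weights, rewards and next states become noise without being centred.
  let w : Bool → ℝ := fun c => if c then 1 / 2 else -(1 / 2)
  have hw : w true + w false = 0 := by simp [w]
  have hn1 : ∀ᵐ ω ∂μ, ∀ x : S × A, ∃ l, Tendsto (fun n => ∑ t ∈ Finset.range n,
      X.α t ω x.1 x.2 * 1 * (w (X.updA t ω) * (2 * (X.outcome t ω).2))) atTop (𝓝 l) :=
    ae_all_iff.2 fun x => X.ae_exists_tendsto_sum_noise hα w (g := fun p => 2 * p.2)
      (measurable_snd.const_mul _) ((hr _ _).const_mul _) (by rw [hw, zero_mul])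
      (fun _ => measurable_const) (Eventually.of_forall fun _ => ⟨1, by simp⟩)
  have hn2 : ∀ᵐ ω ∂μ, ∀ (x : S × A) (s' : S), ∃ l, Tendsto (fun n => ∑ t ∈ Finset.range n,
      X.α t ω x.1 x.2 * X.minValue t ω s' *
        (w (X.updA t ω) * (if (X.outcome t ω).1 = s' then 2 * M.γ else 0))) atTop (𝓝 l) := by
    refine ae_all_iff.2 fun x => ae_all_iff.2 fun s' => ?_
    have := M.law_prob x.1 x.2
    refine X.ae_exists_tendsto_sum_noise hα w (measurable_ite_fst_eq s' (2 * M.γ))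
      (memLp_ite_fst_eq _ s' _) (by rw [hw, zero_mul]) (fun t => X.measurable_minValue t s') ?_
    filter_upwards [hbdd] with ω ⟨B, hB⟩
    have : Nonempty A := ⟨x.2⟩
    exact ⟨B, fun t => X.abs_minValue_le (fun s a => (hB t s a).1) (fun s a => (hB t s a).2) s'⟩
  -- The updated table is half the sum of the tables plus or minus half their difference. The
  -- difference yields the damping α/2, and the sum carries the coin sign. The term γ gap shifts the
  -- clipped value to the midpoint of its interval.
  have hn3 : ∀ᵐ ω ∂μ, ∀ x : S × A, ∃ l, Tendsto (fun n => ∑ t ∈ Finset.range n,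
      X.α t ω x.1 x.2 * (M.γ * X.gap t ω + X.QA t ω x.1 x.2 + X.QB t ω x.1 x.2) *
        (w (X.updA t ω) * (-1))) atTop (𝓝 l) := by
    refine ae_all_iff.2 fun x => ?_
    have := M.law_prob x.1 x.2
    refine X.ae_exists_tendsto_sum_noise hα w (g := fun _ => -1) measurable_const
      (memLp_const _) (by rw [hw, zero_mul])
      (fun t => (((X.measurable_gap t).const_mul _).add (X.QA_meas t _ _)).add
        (X.QB_meas t _ _)) ?_
    filter_upwards [hbdd] with ω ⟨B, hB⟩
    refine ⟨M.γ * (B + B) + B + B, fun t => ?_⟩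
    have hg : X.gap t ω ≤ B + B := X.gap_le fun s a =>
      (abs_sub _ _).trans (add_le_add (hB t s a).1 (hB t s a).2)
    have hg0 := X.gap_nonneg t ω
    refine (abs_add_le _ _).trans (add_le_add ((abs_add_le _ _).trans
      (add_le_add ?_ (hB t _ _).1)) (hB t _ _).2)
    rw [abs_of_nonneg (mul_nonneg hγ0 hg0)]
    exact mul_le_mul_of_nonneg_left hg hγ0
  filter_upwards [hn1, hn2, hn3, hα, hbdd] with ω hn1 hn2 hn3 hω ⟨B, hB⟩
  have key := tendsto_zero_of_contraction (Z := S × A) (γ := M.γ) (c := fun _ => 0)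
    (Δ := fun t x => X.QA t ω x.1 x.2 - X.QB t ω x.1 x.2)
    (a := fun t x => X.α t ω x.1 x.2 * (1 / 2))
    -- Twice the signed deviation of the clipped value from the midpoint `minValue - gap / 2`; the 2
    -- compensates the rate α/2. As minValue - clippedValue lies in [0, gap], the bracket is at most
    -- `gap` in absolute value.
    (u := fun t x => M.γ * (if X.updA t ω then
        X.gap t ω - 2 * (X.minValue t ω (X.state (t + 1) ω) - X.clippedValue t ω)
      else 2 * (X.minValue t ω (X.state (t + 1) ω) - X.clippedValue t ω) - X.gap t ω))
    (n := fun t x => X.α t ω x.1 x.2 * 1 * (w (X.updA t ω) * (2 * (X.outcome t ω).2))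
      + ∑ s', X.α t ω x.1 x.2 * X.minValue t ω s' *
        (w (X.updA t ω) * (if (X.outcome t ω).1 = s' then 2 * M.γ else 0))
      + X.α t ω x.1 x.2 * (M.γ * X.gap t ω + X.QA t ω x.1 x.2 + X.QB t ω x.1 x.2) *
        (w (X.updA t ω) * (-1)))
    hγ0 hγ1 (fun t x => ?_) (fun t x => ?_) (fun x => ?_) (fun x => ?_) (fun t x => ?_)
    (fun t C hC x => ?_) tendsto_const_nhds ?_
  · rw [Metric.tendsto_nhds]
    intro ε hε
    have h1 : ∀ᶠ t in atTop, ∀ x : S × A, |X.QA t ω x.1 x.2 - X.QB t ω x.1 x.2| < ε := by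
      refine eventually_all.2 fun x => ?_
      filter_upwards [Metric.tendsto_nhds.1 (key x) ε hε] with t ht
      simpa [Real.dist_eq] using ht
    filter_upwards [h1] with t ht
    rw [Real.dist_eq, sub_zero, abs_of_nonneg (X.gap_nonneg t ω)]
    have : Nonempty (S × A) := ⟨(X.state t ω, X.action t ω)⟩
    obtain ⟨x, hx⟩ := exists_eq_ciSup_of_finite
      (f := fun x : S × A => |X.QA t ω x.1 x.2 - X.QB t ω x.1 x.2|)
    rw [gap, ← hx]
    exact ht x
  · have := ((hω x.1 x.2).1 t).1
    positivity
  · have := ((hω x.1 x.2).1 t).2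
    linarith
  · simp only [← Finset.sum_mul]
    exact (hω x.1 x.2).2.1.atTop_mul_const (by norm_num)
  · obtain ⟨l1, h1⟩ := hn1 x
    choose l2 h2 using hn2 x
    obtain ⟨l3, h3⟩ := hn3 x
    refine ⟨_, ((h1.add (tendsto_finsetSum Finset.univ fun s' _ => h2 s')).add h3).congr
      fun n => ?_⟩
    rw [Finset.sum_add_distrib, Finset.sum_add_distrib]
    congr 2
    exact Finset.sum_comm
  · have h1 := X.QA_succ ((hω x.1 x.2).2.2.2 t)
    have h2 := X.QB_succ ((hω x.1 x.2).2.2.2 t)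
    simp only [mul_ite, mul_zero, Finset.sum_ite_eq, Finset.mem_univ, if_true]
    simp only [h1, h2, outcome]
    cases hu : X.updA t ω
    · simp [w]; ring
    · simp [w]; ring
  · have h1 : X.gap t ω ≤ C := X.gap_le fun s a => hC (s, a)
    have h2 := X.clippedValue_le_minValue t ω
    have h3 := X.minValue_sub_gap_le_clippedValue t ω
    rw [abs_mul, abs_of_nonneg hγ0, add_zero]
    refine mul_le_mul_of_nonneg_left ?_ hγ0
    split_ifs
    · exact abs_le.2 ⟨by linarith, by linarith⟩
    · exact abs_le.2 ⟨by linarith, by linarith⟩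
  · exact ⟨B + B, fun t x => (abs_sub _ _).trans (add_le_add (hB t _ _).1 (hB t _ _).2)⟩

open Classical in
/-- The first table almost surely converges to any solution of the Bellman optimality equation. -/
theorem ae_tendsto_QA (hγ0 : 0 ≤ M.γ) (hγ1 : M.γ < 1) (hα : X.RobbinsMonro)
    (hr : ∀ s a, MemLp (fun p : S × ℝ => p.2) 2 (M.law s a)) {Q : S → A → ℝ}
    (hQ : M.IsOptimalQ Q) :
    ∀ᵐ ω ∂μ, ∀ s a, Tendsto (fun t => X.QA t ω s a) atTop (𝓝 (Q s a)) := by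
  have hbdd := X.ae_bounded hγ0 hγ1 hα hr
  let w : Bool → ℝ := fun c => if c then 1 else 0
  have hn1 : ∀ᵐ ω ∂μ, ∀ x : S × A, ∃ l, Tendsto (fun n => ∑ t ∈ Finset.range n,
      X.α t ω x.1 x.2 * 1 * (w (X.updA t ω) *
        ((X.outcome t ω).2 - M.meanReward x.1 x.2))) atTop (𝓝 l) := by
    refine ae_all_iff.2 fun x => ?_
    have := M.law_prob x.1 x.2
    refine X.ae_exists_tendsto_sum_noise hα w (g := fun p => p.2 - M.meanReward x.1 x.2)
      (measurable_snd.sub_const _) ((hr _ _).sub (memLp_const _)) ?_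
      (fun _ => measurable_const) (Eventually.of_forall fun _ => ⟨1, by simp⟩)
    rw [integral_sub ((hr _ _).integrable (by norm_num)) (integrable_const _)]
    simp [MDP.meanReward]
  have hn2 : ∀ᵐ ω ∂μ, ∀ (x : S × A) (s' : S), ∃ l, Tendsto (fun n => ∑ t ∈ Finset.range n,
      X.α t ω x.1 x.2 * (⨆ a, X.QA t ω s' a) * (w (X.updA t ω) *
        ((if (X.outcome t ω).1 = s' then 1 else 0) - M.trans x.1 x.2 s'))) atTop (𝓝 l) := by
    refine ae_all_iff.2 fun x => ae_all_iff.2 fun s' => ?_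
    have := M.law_prob x.1 x.2
    have hL := memLp_ite_fst_eq (M.law x.1 x.2) s' 1
    refine X.ae_exists_tendsto_sum_noise hα w
      (g := fun p => (if p.1 = s' then 1 else 0) - M.trans x.1 x.2 s')
      ((measurable_ite_fst_eq s' 1).sub_const _) (hL.sub (memLp_const _)) ?_
      (fun t => X.measurable_iSup_QA t s') ?_
    · rw [integral_sub (hL.integrable (by norm_num)) (integrable_const _), integral_ite_fst_eq]
      simp
    · filter_upwards [hbdd] with ω ⟨B, hB⟩
      have : Nonempty A := ⟨x.2⟩
      exact ⟨B, fun t => abs_iSup_le fun a => (hB t s' a).1⟩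
  have hsum : ∀ᵐ ω ∂μ, ∀ x : S × A, Tendsto (fun n => ∑ t ∈ Finset.range n,
      X.α t ω x.1 x.2 * (if X.updA t ω then 1 else 0)) atTop atTop :=
    ae_all_iff.2 fun x => X.ae_tendsto_sum_updA hα x.1 x.2
  obtain ⟨C, hC⟩ := (Set.finite_range fun x : S × A => |Q x.1 x.2|).bddAbove
  filter_upwards [hn1, hn2, hsum, hα, hbdd, X.ae_tendsto_gap hγ0 hγ1 hα hr]
    with ω hn1 hn2 hsum hω ⟨B, hB⟩ hgap
  have : Nonempty A := ⟨X.action 0 ω⟩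
  have key := tendsto_zero_of_contraction (Z := S × A) (γ := M.γ) (c := fun t => M.γ * X.gap t ω)
    (Δ := fun t x => X.QA t ω x.1 x.2 - Q x.1 x.2)
    (a := fun t x => X.α t ω x.1 x.2 * (if X.updA t ω then 1 else 0))
    -- The Bellman contraction term, corrected at updates of Q^A by the loss from clipping, which
    -- lies in [0, gap]. Hence the perturbation is `c t = γ * gap`.
    (u := fun t x => M.γ * ((∑ s', M.trans x.1 x.2 s' * ((⨆ a, X.QA t ω s' a) - ⨆ a, Q s' a)) -
      (if X.updA t ω then (⨆ a, X.QA t ω (X.state (t + 1) ω) a) - X.clippedValue t ω else 0)))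
    (n := fun t x =>
      X.α t ω x.1 x.2 * 1 * (w (X.updA t ω) * ((X.outcome t ω).2 - M.meanReward x.1 x.2))
      + M.γ * ∑ s', X.α t ω x.1 x.2 * (⨆ a, X.QA t ω s' a) * (w (X.updA t ω) *
        ((if (X.outcome t ω).1 = s' then 1 else 0) - M.trans x.1 x.2 s')))
    hγ0 hγ1 (fun t x => ?_) (fun t x => ?_) hsum (fun x => ?_) (fun t x => ?_)
    (fun t D hD x => ?_) (by simpa using hgap.const_mul M.γ) ?_
  · intro s a
    simpa using (key (s, a)).add_const (Q s a)
  · have := ((hω x.1 x.2).1 t).1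
    split_ifs <;> simp [this]
  · have := ((hω x.1 x.2).1 t).2
    split_ifs <;> simp [this]
  · obtain ⟨l1, h1⟩ := hn1 x
    choose l2 h2 using hn2 x
    refine ⟨_, (h1.add ((tendsto_finsetSum Finset.univ fun s' _ => h2 s').const_mul M.γ)).congr
      fun n => ?_⟩
    rw [Finset.sum_add_distrib, ← Finset.mul_sum]
    congr 2
    exact Finset.sum_comm
  · have h1 := X.QA_succ ((hω x.1 x.2).2.2.2 t)
    have h2 := hQ x.1 x.2
    cases hu : X.updA t ω
    · simp [h1, hu, w]
    · simp only [w, if_true, mul_sub, one_mul, mul_one, mul_ite, mul_zero,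
        Finset.sum_sub_distrib, Finset.sum_ite_eq, Finset.mem_univ]
      simp only [h1, hu, outcome, if_true, mul_one]
      have h3 : ∑ s', X.α t ω x.1 x.2 * (⨆ a, X.QA t ω s' a) * M.trans x.1 x.2 s'
          = X.α t ω x.1 x.2 * ∑ s', M.trans x.1 x.2 s' * ⨆ a, X.QA t ω s' a := by
        rw [Finset.mul_sum]
        exact Finset.sum_congr rfl fun s' _ => by ring
      rw [h3]
      linear_combination (-X.α t ω x.1 x.2) * h2
  · have h1 := M.abs_sum_trans_mul_le (f := fun s' => (⨆ a, X.QA t ω s' a) - ⨆ a, Q s' a)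
      (fun s' => abs_iSup_sub_iSup_le fun a => hD (s', a)) x.1 x.2
    have h2 : |if X.updA t ω then (⨆ a, X.QA t ω (X.state (t + 1) ω) a) - X.clippedValue t ω
        else 0| ≤ X.gap t ω := by
      have hg := X.gap_nonneg t ω
      split_ifs with hu
      · have h3 := X.iSup_QA_sub_gap_le_clippedValue hu
        have h4 := (X.clippedValue_le_minValue t ω).trans (min_le_left _ _)
        exact abs_le.2 ⟨by linarith, by linarith⟩
      · simpa using hg
    rw [abs_mul, abs_of_nonneg hγ0, ← mul_add]
    exact mul_le_mul_of_nonneg_left ((abs_sub _ _).trans (add_le_add h1 h2)) hγ0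
  · exact ⟨B + C, fun t x => (abs_sub _ _).trans (add_le_add (hB t _ _).1 (hC ⟨x, rfl⟩))⟩

end Convergence

end Run

end ACCDQ

/-! ### The convergence theorem -/

theorem theorem3 {S A : Type*}
    [Fintype S] [MeasurableSpace S] [DiscreteMeasurableSpace S]
    [Fintype A] [MeasurableSpace A] [DiscreteMeasurableSpace A]
    (M : ACCDQ.MDP S A)
    {Ω : Type*} [MeasurableSpace Ω] (μ : Measure Ω) [IsProbabilityMeasure μ]
    (X : ACCDQ.Run M μ)
    -- discount factor
    (hγ : M.γ ∈ Set.Ico (0 : ℝ) 1)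
    -- the rewards have finite variance
    (hvar : ∀ s a, evariance (fun p : S × ℝ => p.2) (M.law s a) < ⊤)
    -- every state-action pair is sampled infinitely often
    (hvisit : ∀ᵐ ω ∂μ, ∀ s a, ∃ᶠ t in atTop, X.state t ω = s ∧ X.action t ω = a)
    -- both tables are updated infinitely often
    (hupd : ∀ᵐ ω ∂μ, (∃ᶠ t in atTop, X.updA t ω = true) ∧ (∃ᶠ t in atTop, X.updA t ω = false))
    -- learning rates
    (hα : ∀ᵐ ω ∂μ, ∀ s a,
      (∀ t, 0 ≤ X.α t ω s a ∧ X.α t ω s a ≤ 1) ∧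
      Tendsto (fun n => ∑ t ∈ Finset.range n, X.α t ω s a) atTop atTop ∧
      Summable (fun t => X.α t ω s a ^ 2) ∧
      (∀ t, ¬ (s = X.state t ω ∧ a = X.action t ω) → X.α t ω s a = 0)) :
    (∃! Q : S → A → ℝ, M.IsOptimalQ Q) ∧
    ∀ Qstar : S → A → ℝ, M.IsOptimalQ Qstar →
      ∀ᵐ ω ∂μ,
        (∀ s a, Tendsto (fun t => X.QA t ω s a) atTop (𝓝 (Qstar s a))) ∧
        (∀ s a, Tendsto (fun t => X.QB t ω s a) atTop (𝓝 (Qstar s a))) ∧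
        ∀ᶠ t in atTop, ∀ π : ACCDQ.Policy S A,
          (π.IsGreedy (X.QA t ω) ∨ π.IsGreedy (X.QB t ω) ∨
            π.IsGreedy (fun s a => X.QA t ω s a + X.QB t ω s a)) →
          π.IsGreedy Qstar ∧ M.IsOptimalPolicy π := by
  obtain ⟨h0, h1⟩ := hγ
  have hr : ∀ s a, MemLp (fun p : S × ℝ => p.2) 2 (M.law s a) := fun s a => by
    have := M.law_prob s a
    exact (evariance_lt_top_iff_memLp measurable_snd.aestronglyMeasurable).1 (hvar s a)
  obtain ⟨ω₀⟩ := nonempty_of_isProbabilityMeasure μ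
  have : Nonempty A := ⟨X.action 0 ω₀⟩
  refine ⟨M.existsUnique_isOptimalQ h0 h1, fun Q hQ => ?_⟩
  filter_upwards [X.ae_tendsto_QA h0 h1 hα hr hQ, X.swap.ae_tendsto_QA h0 h1 hα hr hQ]
    with ω hA hB
  refine ⟨hA, hB, ?_⟩
  have hAB : ∀ s a, Tendsto (fun t => X.QA t ω s a + X.QB t ω s a) atTop
      (𝓝 ((fun s a => Q s a + Q s a) s a)) := fun s a => (hA s a).add (hB s a)
  filter_upwards [ACCDQ.eventually_isGreedy_imp hA, ACCDQ.eventually_isGreedy_imp hB,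
    ACCDQ.eventually_isGreedy_imp (q := fun t s a => X.QA t ω s a + X.QB t ω s a) hAB]
    with t gA gB gAB π hπ
  have hg : π.IsGreedy Q := by
    rcases hπ with hπ | hπ | hπ
    · exact gA π hπ
    · exact gB π hπ
    -- The limit of the summed tables is 2Q*, which has the same maximizers as Q*.
    · intro s a ha b
      have := gAB π hπ s a ha b
      simp only at this
      linarith
  exact ⟨hg, M.isOptimalPolicy_of_isGreedy h0 h1 hQ hg⟩
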